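/- Let $\Sigma$ be an oriented smooth surface (everything is $C^\infty$). A fundamental pair $(I,II)$ on $\Sigma$ consists of a Riemannian metric $I$ and a real quadratic form $II$; its shape operator $S$ is given by $II(X,Y)=I(SX,Y)$, its mean and extrinsic curvatures are $H=\frac12\operatorname{tr}S$ and $K=\det S$. It is a Codazzi pair if $\nabla_XSY-\nabla_YSX-S[X,Y]=0$ for all smooth vector fields $X,Y$, where $\nabla$ is the Levi-Civita connection of $I$. Let $\mathcal J\subseteq[0,\infty)$ be a non-degenerate interval and $f:\mathcal J\to\mathbb R$ smooth. A Codazzi pair is special Weingarten for $f$ if $H^2-K\in\mathcal J$ and $H=f(H^2-K)$ at every point. Let $\varphi(t)$ be a primitive of $2f'(t^2)$ on $\{t\ge 0: t^2\in\mathcal J\}$ such that $\sinh\varphi(t)/t$ is well defined, i.e. $\varphi(0)=0$ if $0\in\mathcal J$ (then $\sinh\varphi(t)/t$ is given its limit $\varphi'(0)$ at $t=0$). For a Riemannian metric $A$ on $\Sigma$ and a quadratic differential $Q$ which is holomorphic for the conformal structure of $A$, there is a unique function $t:\Sigma\to[0,\infty)$ with $2|Q|=t\,A$. Consider the formulas $$I=-\frac{\sinh\varphi(t)}{t}\,Q+\cosh\varphi(t)\,A-\frac{\sinh\varphi(t)}{t}\,\overline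 Q,\qquad II-f(t^2)\,I=\cosh\varphi(t)\,Q-t\sinh\varphi(t)\,A+\cosh\varphi(t)\,\overline Q.\qquad(*)$$ (1) If $(I,II)$ is a Codazzi pair on $\Sigma$ that is special Weingarten for $f$, then there are a Riemannian metric $A$ and a holomorphic quadratic differential $Q$ for $A$ such that the function $t$ defined by $2|Q|=t\,A$ satisfies $t^2\in\mathcal J$ everywhere, $(I,II)$ is given by $(*)$, and $t^2=H^2-K$. (2) Conversely, if $A$ is a Riemannian metric and $Q$ a holomorphic quadratic differential for $A$ such that the function $t$ defined by $2|Q|=t\,A$ satisfies $t^2\in\mathcal J$ everywhere, then the formulas $(*)$ define a fundamental pair $(I,II)$ on $\Sigma$ (in particular, $I$ is a smooth Riemannian metric and $II$ is smooth) which is a Codazzi pair and special Weingarten for $f$, with $t^2=H^2-K$. -/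

import Mathlib

open Set Bundle Manifold ContDiff

noncomputable section

namespace CodazziPair

/-- The model plane `ℝ²`. -/
abbrev Plane : Type := EuclideanSpace ℝ (Fin 2)

variable {M : Type*} [TopologicalSpace M] [ChartedSpace Plane M] [IsManifold (𝓡 2) ∞ M]

/-- The tangent plane at `p` of a surface `M`. -/
abbrev Tan (p : M) : Type := TangentSpace (𝓡 2) p

/-- Vector fields on `M`, not necessarily continuous. -/
abbrev VField (M : Type*) [TopologicalSpace M] [ChartedSpace Plane M] : Type _ := ∀ p : M, Tan p

/-- `X` is differentiable at `p`. -/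
abbrev VField.DiffAt (X : VField M) (p : M) : Prop :=
  MDifferentiableAt (𝓡 2) ((𝓡 2).prod 𝓘(ℝ, Plane))
    (fun q ↦ (TotalSpace.mk' Plane q (X q) : TangentBundle (𝓡 2) M)) p

/-- `X` is a smooth vector field. -/
abbrev VField.Smooth (X : VField M) : Prop :=
  ContMDiff (𝓡 2) ((𝓡 2).prod 𝓘(ℝ, Plane)) ∞
    (fun q ↦ (TotalSpace.mk' Plane q (X q) : TangentBundle (𝓡 2) M))

/-- The Lie bracket of vector fields. -/
abbrev bracket (X Y : VField M) : VField M := VectorField.mlieBracket (𝓡 2) X Y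

/-- The derivative `X(u)` at `p` of a function `u` in the direction of the vector field `X`. -/
abbrev deriveAlong {F : Type*} [NormedAddCommGroup F] [NormedSpace ℝ F]
    (X : VField M) (u : M → F) (p : M) : F :=
  mvfderiv (𝓡 2) u p (X p)

/-- The charts `chartAt p` form an oriented atlas. Each tangent plane `T_p M`, which is identified
with `ℝ²` by the chart at `p`, then carries the standard orientation of `ℝ²`. -/
class IsOriented (M : Type*) [TopologicalSpace M] [ChartedSpace Plane M]
    [IsManifold (𝓡 2) ∞ M] : Prop where
  det_pos : ∀ x y p : M, p ∈ (chartAt Plane x).source → p ∈ (chartAt Plane y).source →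
    0 < (tangentCoordChange (𝓡 2) x y p).det

variable (M) in
/-- Smooth Riemannian metrics on `M`. -/
abbrev Metric : Type _ :=
  ContMDiffRiemannianMetric (𝓡 2) ∞ Plane (fun p : M ↦ Tan p)

variable (M) in
/-- Smooth quadratic forms on `M` with values in `F`, given by their polar forms. -/
structure QForm (F : Type*) [NormedAddCommGroup F] [NormedSpace ℝ F] where
  /-- the symmetric bilinear form on the tangent plane at `p` -/
  val (p : M) : Tan p →L[ℝ] Tan p →L[ℝ] F
  symm (p : M) (v w : Tan p) : val p v w = val p w v
  contMDiff : ContMDiff (𝓡 2) ((𝓡 2).prod 𝓘(ℝ, Plane →L[ℝ] Plane →L[ℝ] F)) ∞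
    (fun p ↦ TotalSpace.mk' (Plane →L[ℝ] Plane →L[ℝ] F)
      (E := fun q : M ↦ (Tan q →L[ℝ] Tan q →L[ℝ] Bundle.Trivial M F q)) p (val p))

instance (p : M) : FiniteDimensional ℝ (Tan p) := inferInstanceAs (FiniteDimensional ℝ Plane)

instance (p : M) : T2Space (Tan p) := inferInstanceAs (T2Space Plane)

/-! ### Raising an index -/

/-- The map `T_p M → (T_p M)*`, `v ↦ g(v, ·)`. -/
def flat (g : Metric M) (p : M) : Tan p →ₗ[ℝ] Module.Dual ℝ (Tan p) where
  toFun v := (g.inner p v : Tan p →ₗ[ℝ] ℝ)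
  map_add' v w := by ext; simp
  map_smul' c v := by ext; simp

theorem flat_injective (g : Metric M) (p : M) : Function.Injective (flat g p) := by
  rw [injective_iff_map_eq_zero]
  intro v hv
  by_contra h
  have h1 := g.pos p v h
  have h2 : flat g p v v = 0 := by rw [hv]; rfl
  exact absurd h2 (ne_of_gt h1)

/-- The inverse of `v ↦ g(v, ·)`. -/
def sharp (g : Metric M) (p : M) : Module.Dual ℝ (Tan p) →ₗ[ℝ] Tan p :=
  (LinearEquiv.ofInjectiveOfFinrankEq (flat g p) (flat_injective g p)
    Subspace.dual_finrank_eq.symm).symm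

theorem inner_sharp (g : Metric M) (p : M) (l : Module.Dual ℝ (Tan p)) (w : Tan p) :
    g.inner p (sharp g p l) w = l w :=
  LinearMap.congr_fun ((LinearEquiv.ofInjectiveOfFinrankEq (flat g p) (flat_injective g p)
    Subspace.dual_finrank_eq.symm).apply_symm_apply l) w

/-! ### The Levi-Civita connection -/

/-- The right-hand side of the Koszul formula
`2 g(∇_X Y, Z) = X g(Y,Z) + Y g(X,Z) - Z g(X,Y) + g([X,Y],Z) - g([X,Z],Y) - g([Y,Z],X)`,
divided by two. -/
def koszul (g : Metric M) (X Y Z : VField M) (p : M) : ℝ :=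
  (1 / 2) *
    (deriveAlong X (fun q ↦ g.inner q (Y q) (Z q)) p
      + deriveAlong Y (fun q ↦ g.inner q (X q) (Z q)) p
      - deriveAlong Z (fun q ↦ g.inner q (X q) (Y q)) p
      + g.inner p (bracket X Y p) (Z p)
      - g.inner p (bracket X Z p) (Y p)
      - g.inner p (bracket Y Z p) (X p))

theorem mdifferentiableAt_inner (g : Metric M) {X Y : VField M} {p : M}
    (hX : X.DiffAt p) (hY : Y.DiffAt p) :
    MDifferentiableAt (𝓡 2) 𝓘(ℝ, ℝ) (fun q ↦ g.inner q (X q) (Y q)) p := by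
  have hg := (g.contMDiff p).mdifferentiableAt (by simp)
  have : MDifferentiableAt (𝓡 2) ((𝓡 2).prod 𝓘(ℝ, ℝ))
      (fun q ↦ TotalSpace.mk' ℝ (E := Bundle.Trivial M ℝ) q (g.inner q (X q) (Y q))) p :=
    MDifferentiableAt.clm_bundle_apply₂ (F₁ := Plane) (F₂ := Plane) hg hX hY
  rw [mdifferentiableAt_totalSpace] at this
  exact this.2

theorem koszul_tensorial (g : Metric M) {X Y : VField M} {p : M}
    (hX : X.DiffAt p) (hY : Y.DiffAt p) :
    TensorialAt (𝓡 2) Plane (fun Z : VField M ↦ koszul g X Y Z p) p where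
  smul {u Z} hu hZ := by
    have h1 : (fun q ↦ g.inner q (Y q) ((u • Z) q)) = u * fun q ↦ g.inner q (Y q) (Z q) := by
      ext q; simp
    have h2 : (fun q ↦ g.inner q (X q) ((u • Z) q)) = u * fun q ↦ g.inner q (X q) (Z q) := by
      ext q; simp
    simp only [koszul, deriveAlong, bracket, h1, h2]
    rw [mvfderiv_mul hu (mdifferentiableAt_inner g hY hZ),
      mvfderiv_mul hu (mdifferentiableAt_inner g hX hZ),
      VectorField.mlieBracket_smul_right hu hZ, VectorField.mlieBracket_smul_right hu hZ]
    simp [g.symm p (Z p)]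
    ring
  add {Z W} hZ hW := by
    have h1 : (fun q ↦ g.inner q (Y q) ((Z + W) q)) =
        (fun q ↦ g.inner q (Y q) (Z q)) + fun q ↦ g.inner q (Y q) (W q) := by
      ext q; simp
    have h2 : (fun q ↦ g.inner q (X q) ((Z + W) q)) =
        (fun q ↦ g.inner q (X q) (Z q)) + fun q ↦ g.inner q (X q) (W q) := by
      ext q; simp
    simp only [koszul, deriveAlong, bracket, h1, h2]
    rw [mvfderiv_add (mdifferentiableAt_inner g hY hZ) (mdifferentiableAt_inner g hY hW),
      mvfderiv_add (mdifferentiableAt_inner g hX hZ) (mdifferentiableAt_inner g hX hW),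
      VectorField.mlieBracket_add_right hZ hW, VectorField.mlieBracket_add_right hZ hW]
    simp
    ring

open Classical in
/-- The Levi-Civita connection of `g`: the value `(∇_X Y)(p)` for vector fields `X`, `Y`
differentiable at `p`, determined by the Koszul formula. -/
def leviCivita (g : Metric M) (X Y : VField M) (p : M) : Tan p :=
  if h : X.DiffAt p ∧ Y.DiffAt p then
    sharp g p (TensorialAt.mkHom (fun Z : VField M ↦ koszul g X Y Z p) p
      (koszul_tensorial g h.1 h.2))
  else 0

theorem inner_leviCivita (g : Metric M) {X Y Z : VField M} {p : M}
    (hX : X.DiffAt p) (hY : Y.DiffAt p) (hZ : Z.DiffAt p) :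
    g.inner p (leviCivita g X Y p) (Z p) = koszul g X Y Z p := by
  rw [leviCivita, dif_pos ⟨hX, hY⟩, inner_sharp]
  exact TensorialAt.mkHom_apply (koszul_tensorial g hX hY) hZ

/-! ### Fundamental pairs and Codazzi pairs -/

/-- The shape operator `S` of the pair `(I, II)`: `II(v, w) = I(S v, w)`. -/
def shape (g : Metric M) (h : QForm M ℝ) (p : M) : Tan p →ₗ[ℝ] Tan p where
  toFun v := sharp g p (h.val p v : Tan p →ₗ[ℝ] ℝ)
  map_add' v w := by
    rw [← map_add]; congr 1; ext; simp
  map_smul' c v := by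
    rw [RingHom.id_apply, ← map_smul]; congr 1; ext; simp

theorem inner_shape (g : Metric M) (h : QForm M ℝ) (p : M) (v w : Tan p) :
    g.inner p (shape g h p v) w = h.val p v w :=
  inner_sharp g p _ w

/-- The mean curvature of the pair `(I, II)`. -/
def meanCurv (g : Metric M) (h : QForm M ℝ) (p : M) : ℝ :=
  LinearMap.trace ℝ (Tan p) (shape g h p) / 2

/-- The extrinsic curvature of the pair `(I, II)`. -/
def extCurv (g : Metric M) (h : QForm M ℝ) (p : M) : ℝ :=
  LinearMap.det (shape g h p)

/-- `(I, II)` is a Codazzi pair: `∇_X SY - ∇_Y SX - S[X,Y] = 0` for all smooth vector fields. -/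
def IsCodazzi (g : Metric M) (h : QForm M ℝ) : Prop :=
  ∀ X Y : VField M, X.Smooth → Y.Smooth → ∀ p : M,
    leviCivita g X (fun q ↦ shape g h q (Y q)) p - leviCivita g Y (fun q ↦ shape g h q (X q)) p
      - shape g h p (bracket X Y p) = 0

/-- `(I, II)` is a special Weingarten pair with `H = f(H² - K)`, where `f` is defined on `J`. -/
def IsSpecialWeingarten (J : Set ℝ) (f : ℝ → ℝ) (g : Metric M) (h : QForm M ℝ) : Prop :=
  IsCodazzi g h ∧ ∀ p : M, meanCurv g h p ^ 2 - extCurv g h p ∈ J ∧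
    meanCurv g h p = f (meanCurv g h p ^ 2 - extCurv g h p)

/-! ### Holomorphic quadratic differentials -/

/-- The `i`-th vector of the standard, positively oriented, basis of `T_p M = ℝ²`. -/
def stdVec (p : M) (i : Fin 2) : Tan p := (EuclideanSpace.single i (1 : ℝ) : Plane)

/-- The complex structure of the oriented surface `(M, g)`: the rotation of `T_p M` by a quarter
turn, in the positive direction. -/
def rot (g : Metric M) (p : M) (v : Tan p) : Tan p :=
  (√(g.inner p (stdVec p 0) (stdVec p 0) * g.inner p (stdVec p 1) (stdVec p 1)
      - g.inner p (stdVec p 0) (stdVec p 1) ^ 2))⁻¹ •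
    (g.inner p v (stdVec p 0) • stdVec p 1 - g.inner p v (stdVec p 1) • stdVec p 0)

/-- The value at `p` of `(L_W Q)(X, Y)`, where `L_W` is the Lie derivative. -/
def lieDeriv (Q : QForm M ℂ) (W X Y : VField M) (p : M) : ℂ :=
  deriveAlong W (fun q ↦ Q.val q (X q) (Y q)) p
    - Q.val p (bracket W X p) (Y p) - Q.val p (X p) (bracket W Y p)

/-- `Q` is a holomorphic quadratic differential on the Riemann surface that `g` and the orientation
define. It is of type `(2,0)`, that is, of the form `h dz²` for a local conformal parameter `z`, and
`∂̄Q = 0`. Here `∂̄Q` is evaluated on the vector field `W + i JW` of type `(0,1)`, on which it is the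
Lie derivative of `Q`: for `W = ∂/∂x`, where `z = x + i y`, it is `(h_x + i h_y) dz²`. -/
structure IsHolomorphicQuadDiff (g : Metric M) (Q : QForm M ℂ) : Prop where
  type_two_zero : ∀ (p : M) (v w : Tan p), Q.val p (rot g p v) w = Complex.I * Q.val p v w
  dbar_eq_zero : ∀ W X Y : VField M, W.Smooth → X.Smooth → Y.Smooth → ∀ p : M,
    lieDeriv Q W X Y p + Complex.I * lieDeriv Q (fun q ↦ rot g q (W q)) X Y p = 0

/-- `t : M → [0, ∞)` is the function with `2 |Q| = t g`. -/
def IsModulus (g : Metric M) (Q : QForm M ℂ) (t : M → ℝ) : Prop :=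
  ∀ p : M, 0 ≤ t p ∧ ∀ v : Tan p, 2 * ‖Q.val p v v‖ = t p * g.inner p v v

/-! ### The representation formula -/

/-- The function `sinh φ(t) / t`, with its limit `φ'(0)` as value at `0`. -/
def sinhDiv (φ : ℝ → ℝ) (t : ℝ) : ℝ :=
  if t = 0 then derivWithin φ (Ici 0) 0 else Real.sinh (φ t) / t

/-- On `J`, the function `φ` is a primitive of `2 f'(t²)`, as a function of `t ≥ 0` with `t² ∈ J`;
and `sinh φ(t) / t` has a finite limit at `t = 0` if `0 ∈ J`, that is, `φ(0) = 0`. -/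
structure IsAdmissiblePrimitive (J : Set ℝ) (f φ : ℝ → ℝ) : Prop where
  hasDeriv : ∀ t : ℝ, 0 ≤ t → t ^ 2 ∈ J →
    HasDerivWithinAt φ (2 * derivWithin f J (t ^ 2)) {s : ℝ | 0 ≤ s ∧ s ^ 2 ∈ J} t
  map_zero : 0 ∈ J → φ 0 = 0

/-- The pair `(I, II)` is given by `f`, `φ`, `A`, `Q`, `t` through
`I = -(sinh φ(t) / t) Q + cosh φ(t) A - (sinh φ(t) / t) Q̄` and
`II - f(t²) I = cosh φ(t) Q - t sinh φ(t) A + cosh φ(t) Q̄`. -/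
structure IsGivenBy (f φ : ℝ → ℝ) (g : Metric M) (h : QForm M ℝ) (A : Metric M) (Q : QForm M ℂ)
    (t : M → ℝ) : Prop where
  first : ∀ (p : M) (v w : Tan p), ((g.inner p v w : ℝ) : ℂ) =
    -sinhDiv φ (t p) * Q.val p v w + Real.cosh (φ (t p)) * A.inner p v w
      - sinhDiv φ (t p) * (starRingEnd ℂ) (Q.val p v w)
  second : ∀ (p : M) (v w : Tan p), ((h.val p v w - f (t p ^ 2) * g.inner p v w : ℝ) : ℂ) =
    Real.cosh (φ (t p)) * Q.val p v w - (t p * Real.sinh (φ (t p)) : ℝ) * A.inner p v w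
      + Real.cosh (φ (t p)) * (starRingEnd ℂ) (Q.val p v w)

end CodazziPair

end

/-!
Write `β = II - H I` for the trace-free part of `II`, `u = H² - K`, `B = 2 Re Q`, and
`C = cosh φ(√u)`, `G = sinh φ(√u) / √u`, so that `C² - u G² = 1`. The representation formula reads
`I = C A - G B`, `β = C B - u G A`: it is a hyperbolic rotation of the pair `(A, B)`, with inverse
`A = C I + G β`, `B = C β + u G I`. Such a rotation maps a pair of a metric and a trace-free form
of determinant `-u` to another one (`exists_hyperbolic_rotation`). The trace-free forms are the real
parts of the forms of type `(2,0)` (`exists_type_two_zero`, `isTraceFree_twiceRe`), and `-u` is the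
determinant of `2 Re Q` if and only if `4 |Q|² = u A²`. Hence the formula is a bijection between the
pairs `(A, Q)` and the pairs `(I, II)` with `H = f(H² - K)`, as far as algebra is concerned.

The differential equations also correspond. At a point `p`, choose an `A`-unit vector `v` with
`Q(v, v) = √u / 2`, which exists by `exists_adapted_vector`, and extend `v`, `Jv` to vector fields
that are constant in the chart at `p`. There, the derivatives of `I` and `II` are expressed by those
of `A`, `Q` and `u`, through `C' = f' G` and `2 s G' = 2 f' C - G`. It turns out that the two
components of the Codazzi tensor of `(I, II)` are `(C ∓ √u G)` times two numbers `c₁`, `c₂`, the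
components of the Codazzi tensor of `(A, B)`, while the components of `∂̄Q` are multiples of
`c₂ + i c₁` (`exists_codazzi_dbar`). As `C ∓ √u G ≠ 0`, the Codazzi equation and `∂̄Q = 0` are
equivalent (`isCodazzi_iff_dbar_eq_zero`). Both operators are tensorial, so that the two vector
fields suffice.

Finally, the forms have to be smooth where `u = 0` as well. This comes down to the smoothness of
`C` and `G` as functions of `s = u` on `J`, up to the end point `0`. It follows from `C' = f' G` and,
if `0 ∈ J`, from the integral formula `G(s) = ∫₀¹ 2 (C f')(τ² s) dτ`, because such a mean is as
smooth as its integrand (`contDiffOn_sqMean`, `contDiffOn_coshSqrt_sinhSqrt`).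
-/

noncomputable section

namespace CodazziPair

set_option linter.unusedSectionVars false

variable {M : Type*} [TopologicalSpace M] [ChartedSpace Plane M] [IsManifold (𝓡 2) ∞ M]

/-! ### Pointwise algebra of a metric on a plane -/

section

/-- The Gram determinant of two tangent vectors. -/
def gram (g : Metric M) (p : M) (v w : Tan p) : ℝ :=
  g.inner p v v * g.inner p w w - g.inner p v w ^ 2

theorem stdVec_expand (p : M) (v : Tan p) :
    v = (show Plane from v) 0 • stdVec p 0 + (show Plane from v) 1 • stdVec p 1 := by
  change (show Plane from v) = (show Plane from v) 0 • (EuclideanSpace.single 0 (1:ℝ) : Plane)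
    + (show Plane from v) 1 • (EuclideanSpace.single 1 (1:ℝ) : Plane)
  ext i
  fin_cases i <;> simp

theorem stdVec_ne_zero (p : M) (i : Fin 2) : stdVec p i ≠ 0 := by
  change (EuclideanSpace.single i (1:ℝ) : Plane) ≠ 0
  simp

theorem finrank_tan (p : M) : Module.finrank ℝ (Tan p) = 2 := by
  change Module.finrank ℝ Plane = 2
  simp

theorem inner_self_nonneg (g : Metric M) (p : M) (v : Tan p) : 0 ≤ g.inner p v v := by
  by_cases h : v = 0
  · simp [h]
  · exact (g.pos p v h).le

theorem eq_zero_of_inner_self (g : Metric M) {p : M} {v : Tan p} (h : g.inner p v v = 0) :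
    v = 0 := by
  by_contra hv
  exact (g.pos p v hv).ne' h

theorem gram_comb (g : Metric M) (p : M) (v w : Tan p) (a b c d : ℝ) :
    gram g p (a • v + b • w) (c • v + d • w) = (a * d - b * c) ^ 2 * gram g p v w := by
  simp only [gram, map_add, map_smul, add_apply, smul_apply, smul_eq_mul,
    g.symm p w v]
  ring

theorem gram_stdVec_pos (g : Metric M) (p : M) : 0 < gram g p (stdVec p 0) (stdVec p 1) := by
  set e := stdVec p 0
  set f := stdVec p 1
  have he : 0 < g.inner p e e := g.pos p e (stdVec_ne_zero p 0)
  have hz : g.inner p e f • e - g.inner p e e • f ≠ 0 := by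
    intro h
    have h1 : (g.inner p e f • (EuclideanSpace.single 0 (1:ℝ) : Plane)
      - g.inner p e e • (EuclideanSpace.single 1 (1:ℝ) : Plane)) = 0 := h
    have h2 := congrArg (fun x : Plane ↦ x 1) h1
    simp at h2
    exact he.ne' h2
  have h := g.pos p _ hz
  simp only [map_sub, map_smul, sub_apply, smul_apply, smul_eq_mul,
    g.symm p f e] at h
  have h2 : 0 < g.inner p e e * gram g p e f := by
    rw [gram]; linarith
  exact pos_of_mul_pos_right h2 he.le

theorem linearIndependent_of_gram_ne_zero (g : Metric M) {p : M} {v w : Tan p}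
    (h : gram g p v w ≠ 0) : LinearIndependent ℝ ![v, w] := by
  rw [LinearIndependent.pair_iff]
  intro a b hab
  have h1 : a * g.inner p v v + b * g.inner p v w = 0 := by
    simpa using congrArg (g.inner p v) hab
  have h2 : a * g.inner p v w + b * g.inner p w w = 0 := by
    simpa [g.symm p w v] using congrArg (g.inner p w) hab
  unfold gram at h
  constructor
  · refine (mul_eq_zero.1 ?_).resolve_right h
    linear_combination g.inner p w w * h1 - g.inner p v w * h2
  · refine (mul_eq_zero.1 ?_).resolve_right h
    linear_combination g.inner p v v * h2 - g.inner p v w * h1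

theorem expand_of_gram_ne_zero (g : Metric M) {p : M} {v w : Tan p} (h : gram g p v w ≠ 0)
    (x : Tan p) : ∃ a b : ℝ, x = a • v + b • w := by
  let b : Module.Basis (Fin 2) ℝ (Tan p) := basisOfLinearIndependentOfCardEqFinrank
    (linearIndependent_of_gram_ne_zero g h) (by simp [finrank_tan])
  refine ⟨b.repr x 0, b.repr x 1, ?_⟩
  conv_lhs => rw [← b.sum_repr x]
  simp [Fin.sum_univ_two, b]

theorem ext_of_gram_ne_zero (g : Metric M) {p : M} {v w : Tan p} (h : gram g p v w ≠ 0)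
    {x y : Tan p} (h1 : g.inner p x v = g.inner p y v) (h2 : g.inner p x w = g.inner p y w) :
    x = y := by
  obtain ⟨a, b, hab⟩ := expand_of_gram_ne_zero g h (x - y)
  have : g.inner p (x - y) (x - y) = 0 := by
    conv_lhs => rw [hab]
    rw [map_add, map_smul, map_smul, ← hab]
    simp [h1, h2]
  exact sub_eq_zero.1 (eq_zero_of_inner_self g this)

theorem ext_inner (g : Metric M) {p : M} {x y : Tan p}
    (h : ∀ w, g.inner p x w = g.inner p y w) : x = y :=
  ext_of_gram_ne_zero g (gram_stdVec_pos g p).ne' (h _) (h _)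

/-! ### The rotation by a quarter turn -/

/-- The rotation by a quarter turn, computed in an arbitrary positively oriented basis. -/
theorem rot_eq_of_comb (g : Metric M) (p : M) (x : Tan p) {a b c d : ℝ}
    (hdet : 0 < a * d - b * c) {v w : Tan p}
    (hv : v = a • stdVec p 0 + b • stdVec p 1) (hw : w = c • stdVec p 0 + d • stdVec p 1) :
    rot g p x = (√(gram g p v w))⁻¹ • (g.inner p x v • w - g.inner p x w • v) := by
  rw [hv, hw, gram_comb, Real.sqrt_mul (sq_nonneg _), Real.sqrt_sq hdet.le, rot, ← gram]
  simp only [map_add, map_smul, smul_eq_mul, mul_inv, smul_sub, smul_add, smul_smul]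
  have h1 : (a * d - b * c) ≠ 0 := hdet.ne'
  set s := (√(gram g p (stdVec p 0) (stdVec p 1)))⁻¹
  set k := (a * d - b * c)⁻¹ with hk
  have hk1 : k * (a * d - b * c) = 1 := by rw [hk]; field_simp
  match_scalars
  · linear_combination (-s * g.inner p x (stdVec p 0)) * hk1
  · linear_combination (s * g.inner p x (stdVec p 1)) * hk1

theorem rot_add (g : Metric M) (p : M) (x y : Tan p) : rot g p (x + y) = rot g p x + rot g p y := by
  simp only [rot, map_add, add_apply]
  module

theorem rot_smul (g : Metric M) (p : M) (c : ℝ) (x : Tan p) : rot g p (c • x) = c • rot g p x := by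
  simp only [rot, map_smul, smul_apply, smul_eq_mul]
  module

theorem inner_rot_left (g : Metric M) (p : M) (x y : Tan p) :
    g.inner p (rot g p x) y = (√(gram g p (stdVec p 0) (stdVec p 1)))⁻¹ *
      (g.inner p x (stdVec p 0) * g.inner p (stdVec p 1) y
        - g.inner p x (stdVec p 1) * g.inner p (stdVec p 0) y) := by
  simp [rot, gram]

theorem inner_rot_self (g : Metric M) (p : M) (x : Tan p) : g.inner p (rot g p x) x = 0 := by
  rw [inner_rot_left, g.symm p x (stdVec p 0), g.symm p x (stdVec p 1)]
  ring

theorem inner_rot_rot (g : Metric M) (p : M) (x y : Tan p) :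
    g.inner p (rot g p x) (rot g p y) = g.inner p x y := by
  have hs := gram_stdVec_pos g p
  have hr : (√(gram g p (stdVec p 0) (stdVec p 1)))⁻¹ ^ 2 * gram g p (stdVec p 0) (stdVec p 1)
      = 1 := by
    rw [inv_pow, Real.sq_sqrt hs.le]; field_simp
  rw [inner_rot_left, g.symm p (stdVec p 1) (rot g p y), g.symm p (stdVec p 0) (rot g p y),
    inner_rot_left, inner_rot_left]
  set r := (√(gram g p (stdVec p 0) (stdVec p 1)))⁻¹
  rw [stdVec_expand p x, stdVec_expand p y]
  set a := (show Plane from x) 0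
  set b := (show Plane from x) 1
  set c := (show Plane from y) 0
  set d := (show Plane from y) 1
  unfold gram at hr
  simp only [map_add, map_smul, add_apply, smul_apply, smul_eq_mul,
    g.symm p (stdVec p 1) (stdVec p 0)]
  set E := g.inner p (stdVec p 0) (stdVec p 0)
  set F := g.inner p (stdVec p 0) (stdVec p 1)
  set G := g.inner p (stdVec p 1) (stdVec p 1)
  linear_combination (a * c * E + a * d * F + b * c * F + b * d * G) * hr

theorem inner_rot_comm (g : Metric M) (p : M) (x y : Tan p) :
    g.inner p (rot g p x) y = - g.inner p x (rot g p y) := by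
  have h := inner_rot_self g p (x + y)
  simp only [rot_add, map_add, add_apply, inner_rot_self] at h
  rw [g.symm p x]
  linarith

theorem rot_rot (g : Metric M) (p : M) (x : Tan p) : rot g p (rot g p x) = -x := by
  refine ext_inner g fun w ↦ ?_
  rw [inner_rot_comm, inner_rot_rot]
  simp

theorem gram_rot (g : Metric M) (p : M) (x : Tan p) :
    gram g p x (rot g p x) = g.inner p x x ^ 2 := by
  rw [gram, inner_rot_rot, g.symm p x (rot g p x), inner_rot_self]; ring

/-! ### Trace and determinant of the shape operator -/

/-- The matrix of `S` in a basis `v, w` is found by Cramer's rule, whose denominator is the Gram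
determinant. -/
theorem trace_det_shape (g : Metric M) (h : QForm M ℝ) (p : M) {v w : Tan p}
    (hvw : gram g p v w ≠ 0) :
    LinearMap.trace ℝ (Tan p) (shape g h p) * gram g p v w
      = g.inner p w w * h.val p v v - 2 * g.inner p v w * h.val p v w
        + g.inner p v v * h.val p w w ∧
    LinearMap.det (shape g h p) * gram g p v w = h.val p v v * h.val p w w - h.val p v w ^ 2 := by
  let b : Module.Basis (Fin 2) ℝ (Tan p) := basisOfLinearIndependentOfCardEqFinrank
    (linearIndependent_of_gram_ne_zero g hvw) (by simp [finrank_tan])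
  have hb0 : b 0 = v := by simp [b]
  have hb1 : b 1 = w := by simp [b]
  have hS : ∀ x, shape g h p x = b.repr (shape g h p x) 0 • v + b.repr (shape g h p x) 1 • w := by
    intro x
    conv_lhs => rw [← b.sum_repr (shape g h p x), Fin.sum_univ_two, hb0, hb1]
  have e1 : ∀ x y, h.val p x y = b.repr (shape g h p x) 0 * g.inner p v y
      + b.repr (shape g h p x) 1 * g.inner p w y := by
    intro x y
    rw [← inner_shape g h p x y]
    conv_lhs => rw [hS x]
    simp
  have ht : LinearMap.trace ℝ (Tan p) (shape g h p)
      = b.repr (shape g h p v) 0 + b.repr (shape g h p w) 1 := by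
    rw [LinearMap.trace_eq_matrix_trace ℝ b, Matrix.trace_fin_two, LinearMap.toMatrix_apply,
      LinearMap.toMatrix_apply, hb0, hb1]
  have hd : LinearMap.det (shape g h p)
      = b.repr (shape g h p v) 0 * b.repr (shape g h p w) 1
        - b.repr (shape g h p w) 0 * b.repr (shape g h p v) 1 := by
    rw [← LinearMap.det_toMatrix b, Matrix.det_fin_two, LinearMap.toMatrix_apply,
      LinearMap.toMatrix_apply, LinearMap.toMatrix_apply, LinearMap.toMatrix_apply, hb0, hb1]
  have hsym := h.symm p v w
  rw [e1 v w, e1 w v] at hsym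
  rw [ht, hd, e1 v v, e1 v w, e1 w w]
  simp only [gram, g.symm p w v] at *
  constructor
  · linear_combination g.inner p v w * hsym
  · linear_combination (b.repr (shape g h p v) 0 * g.inner p v w
      + b.repr (shape g h p v) 1 * g.inner p w w) * hsym

end

section

/-! ### Coordinate vector fields -/

/-- A vector field with value `v` at `p` whose coordinates are constant near `p`, in the chart at
`p`. It is cut off outside of that chart. -/
def coordField (p : M) (v : Tan p) : VField M :=
  fun q ↦ (Classical.arbitrary (SmoothBumpFunction (𝓡 2) p)) q • FiberBundle.extend Plane v q

theorem coordField_self (p : M) (v : Tan p) : coordField p v p = v := by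
  simp [coordField, SmoothBumpFunction.eq_one]

theorem coordField_eventuallyEq_extend (p : M) (v : Tan p) :
    ∀ᶠ q in nhds p, coordField p v q = FiberBundle.extend Plane v q := by
  filter_upwards [(Classical.arbitrary (SmoothBumpFunction (𝓡 2) p)).eventuallyEq_one] with q hq
  simp [coordField, hq]

theorem extend_eq_symmL (p : M) (v : Tan p) {q : M} (hq : q ∈ (chartAt Plane p).source) :
    FiberBundle.extend Plane v q =
      (trivializationAt Plane (fun q : M ↦ Tan q) p).symmL ℝ q (show Plane from v) := by
  have hp : p ∈ (chartAt Plane p).source := mem_chart_source _ p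
  have h3 : (trivializationAt Plane (fun q : M ↦ Tan q) p ⟨p, v⟩).2 = (show Plane from v) := by
    rw [TangentBundle.trivializationAt_apply]
    exact tangentCoordChange_self (I := 𝓡 2) (mem_extChartAt_source p)
  have hqt : q ∈ (trivializationAt Plane (fun q : M ↦ Tan q) p).baseSet := by simpa using hq
  exact (congrArg _ h3).trans (Trivialization.symmL_apply (R := ℝ) _ hqt _).symm

theorem extend_eq_tangentCoordChange (p : M) (v : Tan p) {q : M}
    (hq : q ∈ (chartAt Plane p).source) :
    FiberBundle.extend Plane v q = tangentCoordChange (𝓡 2) p q q (show Plane from v) := by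
  rw [extend_eq_symmL p v hq]
  exact congrArg (fun T ↦ T (show Plane from v))
    (TangentBundle.symmL_trivializationAt_eq_core (I := 𝓡 2) hq)

theorem contMDiffOn_extend (p : M) (v : Tan p) :
    ContMDiffOn (𝓡 2) ((𝓡 2).prod 𝓘(ℝ, Plane)) ∞
      (fun q ↦ (TotalSpace.mk' Plane q (FiberBundle.extend Plane v q) : TangentBundle (𝓡 2) M))
      (chartAt Plane p).source := by
  intro q hq
  set t := trivializationAt Plane (fun q : M ↦ Tan q) p with ht
  have hqt : q ∈ t.baseSet := by simpa [t] using hq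
  rw [t.contMDiffWithinAt_section _ hqt]
  refine (contMDiffWithinAt_const (c := (t ⟨p, v⟩).2)).congr_of_mem (fun x hx ↦ ?_) hq
  have hxt : x ∈ t.baseSet := by simpa [t] using hx
  simp [FiberBundle.extend, hxt, ← ht]

theorem coordField_smooth [T2Space M] (p : M) (v : Tan p) : (coordField p v).Smooth :=
  ContMDiffOn.smul_section_of_tsupport (u := (chartAt Plane p).source)
    (SmoothBumpFunction.contMDiff _).contMDiffOn (chartAt Plane p).open_source
    (SmoothBumpFunction.tsupport_subset_chartAt_source _) (contMDiffOn_extend p v)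

/-- Near `p`, coordinate fields are the pullbacks of constant fields on the plane by the chart. -/
theorem coordField_bracket [T2Space M] (p : M) (v w : Tan p) :
    bracket (coordField p v) (coordField p w) p = 0 := by
  let c : Plane → ∀ x : Plane, TangentSpace 𝓘(ℝ, Plane) x := fun v _ ↦ v
  have key : ∀ v : Tan p, coordField p v =ᶠ[nhds p]
      VectorField.mpullback (𝓡 2) 𝓘(ℝ, Plane) (extChartAt (𝓡 2) p) (c v) := by
    intro v
    filter_upwards [coordField_eventuallyEq_extend p v,
      (chartAt Plane p).open_source.mem_nhds (mem_chart_source _ p)] with q h1 h2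
    rw [h1, extend_eq_symmL p v h2, VectorField.mpullback_apply]
    have h3 := TangentBundle.continuousLinearMapAt_trivializationAt (I := 𝓡 2) h2
    have hqt : q ∈ (trivializationAt Plane (fun q : M ↦ Tan q) p).baseSet := by simpa using h2
    have h4 : (mfderiv (𝓡 2) 𝓘(ℝ, Plane) (extChartAt (𝓡 2) p) q).inverse =
        (trivializationAt Plane (fun q : M ↦ Tan q) p).symmL ℝ q := by
      rw [← h3]
      apply ContinuousLinearMap.inverse_eq
      · ext y
        exact Trivialization.continuousLinearMapAt_symmL _ hqt y
      · ext y
        exact Trivialization.symmL_continuousLinearMapAt (R := ℝ) _ hqt y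
    rw [h4]
    rfl
  have hc : ∀ v : Plane, ∀ x : Plane, MDifferentiableAt 𝓘(ℝ, Plane) (𝓘(ℝ, Plane).prod 𝓘(ℝ, Plane))
      (fun q ↦ (TotalSpace.mk' Plane q (c v q) : TangentBundle 𝓘(ℝ, Plane) Plane)) x := by
    intro v x
    refine ContMDiffAt.mdifferentiableAt (n := 1) ?_ one_ne_zero
    exact contMDiffAt_vectorSpace_iff_contDiffAt.2 contDiffAt_const
  have h0 : VectorField.mlieBracket 𝓘(ℝ, Plane) (c v) (c w) = 0 := by
    rw [← VectorField.mlieBracketWithin_univ, VectorField.mlieBracketWithin_eq_lieBracketWithin,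
      show VectorField.lieBracketWithin ℝ (c v) (c w) univ = VectorField.lieBracket ℝ (c v) (c w)
        from VectorField.lieBracketWithin_univ]
    ext1 x
    have h1 (a b y z : Plane) :
        fderiv ℝ (fun _ : Plane ↦ a) x y - fderiv ℝ (fun _ : Plane ↦ b) x z = 0 := by simp
    exact h1 w v _ _
  have hle : (2 : WithTop ℕ∞) ≤ ∞ := WithTop.coe_le_coe.2 le_top
  have : IsManifold (𝓡 2) (minSmoothness ℝ 2) M := by
    rw [minSmoothness_of_isRCLikeNormedField]
    exact IsManifold.of_le hle
  have hm : ContMDiffAt (𝓡 2) 𝓘(ℝ, Plane) ∞ (extChartAt (𝓡 2) p) p := contMDiffAt_extChartAt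
  have h5 := VectorField.mpullback_mlieBracket (n := ∞) (hc v _) (hc w _) hm (by simp [hle])
  rw [h0, VectorField.mpullback_zero] at h5
  exact ((key v).mlieBracket_vectorField_eq (key w)).trans h5.symm

/-! ### Smoothness -/

theorem QForm.contMDiffAt_apply {F : Type*} [NormedAddCommGroup F] [NormedSpace ℝ F]
    (h : QForm M F) {X Y : VField M} {p : M}
    (hX : ContMDiffAt (𝓡 2) ((𝓡 2).prod 𝓘(ℝ, Plane)) ∞
      (fun q ↦ (TotalSpace.mk' Plane q (X q) : TangentBundle (𝓡 2) M)) p)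
    (hY : ContMDiffAt (𝓡 2) ((𝓡 2).prod 𝓘(ℝ, Plane)) ∞
      (fun q ↦ (TotalSpace.mk' Plane q (Y q) : TangentBundle (𝓡 2) M)) p) :
    ContMDiffAt (𝓡 2) 𝓘(ℝ, F) ∞ (fun q ↦ h.val q (X q) (Y q)) p := by
  have : ContMDiffAt (𝓡 2) ((𝓡 2).prod 𝓘(ℝ, F)) ∞
      (fun q ↦ TotalSpace.mk' F (E := Bundle.Trivial M F) q (h.val q (X q) (Y q))) p :=
    ContMDiffAt.clm_bundle_apply₂ (F₁ := Plane) (F₂ := Plane) (h.contMDiff p) hX hY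
  rw [contMDiffAt_totalSpace] at this
  exact this.2

theorem contMDiffAt_clm_apply {E F : Type*} [NormedAddCommGroup E] [NormedSpace ℝ E]
    [FiniteDimensional ℝ E] [NormedAddCommGroup F] [NormedSpace ℝ F] {f : M → E →L[ℝ] F} {p : M}
    (h : ∀ v, ContMDiffAt (𝓡 2) 𝓘(ℝ, F) ∞ (fun q ↦ f q v) p) :
    ContMDiffAt (𝓡 2) 𝓘(ℝ, E →L[ℝ] F) ∞ f p := by
  let d := Module.finrank ℝ E
  have hd : d = Module.finrank ℝ (Fin d → ℝ) := (Module.finrank_fin_fun ℝ).symm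
  let e₁ := ContinuousLinearEquiv.ofFinrankEq hd
  let e₂ := (e₁.arrowCongr (1 : F ≃L[ℝ] F)).trans (ContinuousLinearEquiv.piRing (Fin d))
  rw [← Function.id_comp f, ← e₂.symm_comp_self]
  exact e₂.symm.contDiff.contMDiff.contMDiffAt.comp p (contMDiffAt_pi_space.2 fun i ↦ h _)

/-- A family of bilinear forms is smooth at `p` if its coefficients on coordinate fields are. -/
theorem contMDiffAt_of_apply {F : Type*} [NormedAddCommGroup F] [NormedSpace ℝ F]
    (s : ∀ p : M, Tan p →L[ℝ] Tan p →L[ℝ] F) (p : M)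
    (hs : ∀ v w : Tan p, ContMDiffAt (𝓡 2) 𝓘(ℝ, F) ∞
      (fun q ↦ s q (coordField p v q) (coordField p w q)) p) :
    ContMDiffAt (𝓡 2) ((𝓡 2).prod 𝓘(ℝ, Plane →L[ℝ] Plane →L[ℝ] F)) ∞
    (fun p ↦ TotalSpace.mk' (Plane →L[ℝ] Plane →L[ℝ] F)
      (E := fun q : M ↦ (Tan q →L[ℝ] Tan q →L[ℝ] Bundle.Trivial M F q)) p (s p)) p := by
  rw [contMDiffAt_section]
  have key : ∀ᶠ q in nhds p, ∀ v w : Plane,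
     ((trivializationAt (Plane →L[ℝ] Plane →L[ℝ] F)
     (fun q : M ↦ (Tan q →L[ℝ] Tan q →L[ℝ] Bundle.Trivial M F q)) p) ⟨q, s q⟩).2 v w
     = s q (coordField p v q) (coordField p w q) := by
    have hb := (trivializationAt Plane (fun q : M ↦ Tan q) p).open_baseSet.mem_nhds
      (FiberBundle.mem_baseSet_trivializationAt' p)
    filter_upwards [hb,
      (chartAt Plane p).open_source.mem_nhds (mem_chart_source _ p),
      (Classical.arbitrary (SmoothBumpFunction (𝓡 2) p)).eventuallyEq_one] with q h1 h2 h3 v w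
    have h4 : ∀ v : Plane, coordField p v q =
        (trivializationAt Plane (fun q : M ↦ Tan q) p).symm q v := by
      intro v
      have : coordField p v q = FiberBundle.extend Plane (show Tan p from v) q := by
        simp [coordField, h3]
      rw [this, extend_eq_symmL p _ h2, Trivialization.symmL_apply _ h1]
    rw [h4, h4]
    have := inCoordinates_apply_eq₂ (𝕜 := ℝ) (F₁ := Plane) (F₂ := Plane) (F₃ := F)
      (E₁ := fun q : M ↦ Tan q) (E₂ := fun q : M ↦ Tan q) (E₃ := Bundle.Trivial M F)
      (ϕ := s q) (v := v) (w := w) h1 h1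
      (by simp : q ∈ (trivializationAt F (Bundle.Trivial M F) p).baseSet)
    simp at this
    exact this
  refine (contMDiffAt_clm_apply fun v ↦ contMDiffAt_clm_apply fun w ↦ ?_)
  exact (hs v w).congr_of_eventuallyEq (key.mono fun q hq ↦ hq v w)

end

/-! ### Smoothness of the rotation and of the shape operator -/

section

/-- A Riemannian metric, as a quadratic form. -/
def toQForm (g : Metric M) : QForm M ℝ where
  val := g.inner
  symm := g.symm
  contMDiff := g.contMDiff

theorem QForm.mdifferentiableAt_apply {F : Type*} [NormedAddCommGroup F] [NormedSpace ℝ F]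
    (h : QForm M F) {X Y : VField M} {p : M} (hX : X.DiffAt p) (hY : Y.DiffAt p) :
    MDifferentiableAt (𝓡 2) 𝓘(ℝ, F) (fun q ↦ h.val q (X q) (Y q)) p := by
  have hg := (h.contMDiff p).mdifferentiableAt (by simp)
  have : MDifferentiableAt (𝓡 2) ((𝓡 2).prod 𝓘(ℝ, F))
      (fun q ↦ TotalSpace.mk' F (E := Bundle.Trivial M F) q (h.val q (X q) (Y q))) p :=
    MDifferentiableAt.clm_bundle_apply₂ (F₁ := Plane) (F₂ := Plane) hg hX hY
  rw [mdifferentiableAt_totalSpace] at this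
  exact this.2

theorem VField.Smooth.diffAt {X : VField M} (hX : X.Smooth) (p : M) : X.DiffAt p :=
  (hX p).mdifferentiableAt (by simp)

theorem contMDiffAt_inner (g : Metric M) {X Y : VField M} (hX : X.Smooth) (hY : Y.Smooth) (p : M) :
    ContMDiffAt (𝓡 2) 𝓘(ℝ, ℝ) ∞ (fun q ↦ g.inner q (X q) (Y q)) p :=
  (toQForm g).contMDiffAt_apply (hX p) (hY p)

theorem contMDiffAt_gram (g : Metric M) {X Y : VField M} (hX : X.Smooth) (hY : Y.Smooth) (p : M) :
    ContMDiffAt (𝓡 2) 𝓘(ℝ, ℝ) ∞ (fun q ↦ gram g q (X q) (Y q)) p := by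
  simp only [gram]
  exact ((contMDiffAt_inner g hX hX p).mul (contMDiffAt_inner g hY hY p)).sub
    ((contMDiffAt_inner g hX hY p).pow 2)

section Frame

variable [T2Space M]

theorem eventually_gram_pos (g : Metric M) (p : M) :
    ∀ᶠ q in nhds p, 0 < gram g q (coordField p (stdVec p 0) q) (coordField p (stdVec p 1) q) := by
  have h := (contMDiffAt_gram g (coordField_smooth p (stdVec p 0))
    (coordField_smooth p (stdVec p 1)) p).continuousAt
  refine h.eventually_mem (Ioi_mem_nhds ?_)
  simpa only [coordField_self] using gram_stdVec_pos g p

theorem contMDiffAt_inv_sqrt_gram (g : Metric M) (p : M) :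
    ContMDiffAt (𝓡 2) 𝓘(ℝ, ℝ) ∞ (fun q ↦ (√(gram g q (coordField p (stdVec p 0) q)
      (coordField p (stdVec p 1) q)))⁻¹) p := by
  have h := contMDiffAt_gram g (coordField_smooth p (stdVec p 0))
    (coordField_smooth p (stdVec p 1)) p
  have hp := (eventually_gram_pos g p).self_of_nhds
  have h2 : ContDiffAt ℝ ∞ (fun x : ℝ ↦ (√x)⁻¹) (gram g p (coordField p (stdVec p 0) p)
      (coordField p (stdVec p 1) p)) :=
    (Real.contDiffAt_sqrt hp.ne').inv (Real.sqrt_pos.2 hp).ne'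
  exact ContMDiffAt.comp (I' := 𝓘(ℝ, ℝ)) (g := fun x : ℝ ↦ (√x)⁻¹)
    (f := fun q ↦ gram g q (coordField p (stdVec p 0) q) (coordField p (stdVec p 1) q)) p
    h2.contMDiffAt h

/-- Near `p`, the rotation is given by the coordinate fields of the chart at `p`. This is where the
orientation of the atlas enters. -/
theorem eventually_rot_eq [IsOriented M] (g : Metric M) (p : M) :
    ∀ᶠ q in nhds p, ∀ x : Tan q, rot g q x =
      (√(gram g q (coordField p (stdVec p 0) q) (coordField p (stdVec p 1) q)))⁻¹ •
      (g.inner q x (coordField p (stdVec p 0) q) • coordField p (stdVec p 1) q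
        - g.inner q x (coordField p (stdVec p 1) q) • coordField p (stdVec p 0) q) := by
  filter_upwards [coordField_eventuallyEq_extend p (stdVec p 0),
    coordField_eventuallyEq_extend p (stdVec p 1),
    (chartAt Plane p).open_source.mem_nhds (mem_chart_source _ p)] with q h0 h1 hq x
  rw [h0, h1, extend_eq_tangentCoordChange p _ hq, extend_eq_tangentCoordChange p _ hq]
  set T : Plane →L[ℝ] Plane := tangentCoordChange (𝓡 2) p q q
  have hdet : 0 < T.det := IsOriented.det_pos p q q hq (mem_chart_source _ q)
  set e : Fin 2 → Plane := fun i ↦ EuclideanSpace.single i (1 : ℝ)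
  have hT : T.det = (T (e 0)) 0 * (T (e 1)) 1 - (T (e 0)) 1 * (T (e 1)) 0 := by
    let b := (EuclideanSpace.basisFun (Fin 2) ℝ).toBasis
    rw [ContinuousLinearMap.det, ← LinearMap.det_toMatrix b, Matrix.det_fin_two]
    simp [LinearMap.toMatrix_apply, b, e]
    ring
  rw [hT] at hdet
  exact rot_eq_of_comb g q x hdet (stdVec_expand q _) (stdVec_expand q _)

theorem diffAt_rot [IsOriented M] (g : Metric M) {X : VField M} {p : M} (hX : X.DiffAt p) :
    VField.DiffAt (fun q ↦ rot g q (X q)) p := by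
  set E := coordField p (stdVec p 0) with hE
  set F := coordField p (stdVec p 1) with hF
  have hEd : E.DiffAt p := (coordField_smooth p _).diffAt p
  have hFd : F.DiffAt p := (coordField_smooth p _).diffAt p
  have hs := (contMDiffAt_inv_sqrt_gram g p).mdifferentiableAt (by simp)
  have h : VField.DiffAt (fun q ↦ (√(gram g q (E q) (F q)))⁻¹ •
      (g.inner q (X q) (E q) • F q - g.inner q (X q) (F q) • E q)) p :=
    hs.smul_section (mdifferentiableAt_sub_section
      ((mdifferentiableAt_inner g hX hEd).smul_section hFd)
      ((mdifferentiableAt_inner g hX hFd).smul_section hEd))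
  refine h.congr_of_eventuallyEq ?_
  filter_upwards [eventually_rot_eq g p] with q hq
  rw [hq]

/-- Near `p`, the shape operator is given by the coordinate fields of the chart at `p`, according to
Cramer's rule. -/
theorem eventually_shape_eq (g : Metric M) (h : QForm M ℝ) (p : M) :
    ∀ᶠ q in nhds p, ∀ x : Tan q, shape g h q x =
      (gram g q (coordField p (stdVec p 0) q) (coordField p (stdVec p 1) q))⁻¹ •
      ((h.val q x (coordField p (stdVec p 0) q)
          * g.inner q (coordField p (stdVec p 1) q) (coordField p (stdVec p 1) q)
        - h.val q x (coordField p (stdVec p 1) q)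
          * g.inner q (coordField p (stdVec p 0) q) (coordField p (stdVec p 1) q))
          • coordField p (stdVec p 0) q
      + (h.val q x (coordField p (stdVec p 1) q)
          * g.inner q (coordField p (stdVec p 0) q) (coordField p (stdVec p 0) q)
        - h.val q x (coordField p (stdVec p 0) q)
          * g.inner q (coordField p (stdVec p 0) q) (coordField p (stdVec p 1) q))
          • coordField p (stdVec p 1) q) := by
  filter_upwards [eventually_gram_pos g p] with q hq x
  set E := coordField p (stdVec p 0) q
  set F := coordField p (stdVec p 1) q
  refine ext_of_gram_ne_zero g hq.ne' ?_ ?_ <;> rw [inner_shape] <;>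
    simp only [map_add, map_smul, add_apply, smul_apply, smul_eq_mul, g.symm q F E] <;>
    field_simp <;> rw [gram] <;> ring

theorem diffAt_shape (g : Metric M) (h : QForm M ℝ) {X : VField M} {p : M}
    (hX : X.DiffAt p) : VField.DiffAt (fun q ↦ shape g h q (X q)) p := by
  set E := coordField p (stdVec p 0) with hE
  set F := coordField p (stdVec p 1) with hF
  have hEd : E.DiffAt p := (coordField_smooth p _).diffAt p
  have hFd : F.DiffAt p := (coordField_smooth p _).diffAt p
  have hp := (eventually_gram_pos g p).self_of_nhds
  have hs := ((contMDiffAt_gram g (coordField_smooth p (stdVec p 0))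
    (coordField_smooth p (stdVec p 1)) p).inv₀ hp.ne').mdifferentiableAt (by simp)
  have hEE := mdifferentiableAt_inner g hEd hEd
  have hEF := mdifferentiableAt_inner g hEd hFd
  have hFF := mdifferentiableAt_inner g hFd hFd
  have hXE := h.mdifferentiableAt_apply hX hEd
  have hXF := h.mdifferentiableAt_apply hX hFd
  have key : VField.DiffAt (fun q ↦ (gram g q (E q) (F q))⁻¹ •
      ((h.val q (X q) (E q) * g.inner q (F q) (F q) - h.val q (X q) (F q) * g.inner q (E q) (F q))
          • E q
      + (h.val q (X q) (F q) * g.inner q (E q) (E q) - h.val q (X q) (E q) * g.inner q (E q) (F q))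
          • F q)) p :=
    hs.smul_section (mdifferentiableAt_add_section
      (((hXE.mul hFF).sub (hXF.mul hEF)).smul_section hEd)
      (((hXF.mul hEE).sub (hXE.mul hEF)).smul_section hFd))
  refine key.congr_of_eventuallyEq ?_
  filter_upwards [eventually_shape_eq g h p] with q hq
  rw [hq]

/-- The quadratic form with given values, which is smooth if its values on smooth vector fields
are. -/
def QForm.mk' {F : Type*} [NormedAddCommGroup F] [NormedSpace ℝ F]
    (s : ∀ p : M, Tan p →L[ℝ] Tan p →L[ℝ] F) (symm : ∀ p v w, s p v w = s p w v)
    (smooth : ∀ X Y : VField M, X.Smooth → Y.Smooth → ∀ p,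
      ContMDiffAt (𝓡 2) 𝓘(ℝ, F) ∞ (fun q ↦ s q (X q) (Y q)) p) : QForm M F where
  val := s
  symm := symm
  contMDiff p := contMDiffAt_of_apply s p fun v w ↦
    smooth _ _ (coordField_smooth p v) (coordField_smooth p w) p

end Frame

/-! ### Derivatives along coordinate lines -/

/-- The curve through `p` which is a straight line with velocity `v` in the chart at `p`. -/
def chartLine (p : M) (v : Tan p) (s : ℝ) : M :=
  (extChartAt (𝓡 2) p).symm (extChartAt (𝓡 2) p p + s • (show Plane from v))

theorem chartLine_zero (p : M) (v : Tan p) : chartLine p v 0 = p := by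
  have h (w : Plane) : (extChartAt (𝓡 2) p).symm (extChartAt (𝓡 2) p p + (0 : ℝ) • w) = p := by
    rw [zero_smul, add_zero, extChartAt_to_inv]
  exact h v

theorem inner_chartLine_zero (g : Metric M) (p : M) (x : Tan p) (X Y : VField M) :
    g.inner (chartLine p x 0) (X (chartLine p x 0)) (Y (chartLine p x 0))
      = g.inner p (X p) (Y p) := by
  rw [chartLine_zero]

theorem val_chartLine_zero {F : Type*} [NormedAddCommGroup F] [NormedSpace ℝ F] (h : QForm M F)
    (p : M) (x : Tan p) (X Y : VField M) :
    h.val (chartLine p x 0) (X (chartLine p x 0)) (Y (chartLine p x 0)) = h.val p (X p) (Y p) := by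
  rw [chartLine_zero]

theorem hasDerivAt_chartLine {F : Type*} [NormedAddCommGroup F] [NormedSpace ℝ F] {u : M → F}
    {p : M} (hu : MDifferentiableAt (𝓡 2) 𝓘(ℝ, F) u p) (v : Tan p) :
    HasDerivAt (fun s ↦ u (chartLine p v s)) (mvfderiv (𝓡 2) u p v) 0 := by
  have h : HasFDerivAt (u ∘ (extChartAt (𝓡 2) p).symm) (mvfderiv (𝓡 2) u p : Plane →L[ℝ] F)
      (extChartAt (𝓡 2) p p) := by
    have h := hu.hasMFDerivAt.2
    simp only [writtenInExtChartAt, extChartAt_model_space_eq_id, PartialEquiv.refl_coe,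
      Function.id_comp, ModelWithCorners.range_eq_univ] at h
    exact hasFDerivWithinAt_univ.1 h
  have h2 (x w : Plane) : HasDerivAt (fun s : ℝ ↦ x + s • w) w 0 := by
    simpa using ((hasDerivAt_id (0 : ℝ)).smul_const w).const_add x
  have h3 (x w : Plane) : x = x + (0 : ℝ) • w := by simp
  exact HasFDerivAt.comp_hasDerivAt_of_eq (0 : ℝ) h (h2 (extChartAt (𝓡 2) p p) v) (h3 _ v)

/-- Differentiation in the direction `v`, as a derivative along a curve. -/
theorem mvfderiv_eq_of_hasDerivAt {F : Type*} [NormedAddCommGroup F] [NormedSpace ℝ F] {u : M → F}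
    {p : M} (hu : MDifferentiableAt (𝓡 2) 𝓘(ℝ, F) u p) {v : Tan p} {a : F}
    (h : HasDerivAt (fun s ↦ u (chartLine p v s)) a 0) : mvfderiv (𝓡 2) u p v = a :=
  (hasDerivAt_chartLine hu v).unique h

end

section

/-! ### The Codazzi tensor -/

/-- The compatibility of the Levi-Civita connection with the metric. -/
theorem koszul_add_swap (g : Metric M) {X Y Z : VField M} {p : M} :
    koszul g X Y Z p + koszul g X Z Y p = deriveAlong X (fun q ↦ g.inner q (Y q) (Z q)) p := by
  simp only [koszul, bracket, fun q ↦ g.symm q (Z q) (Y q)]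
  rw [VectorField.mlieBracket_swap_apply (V := Z) (W := Y)]
  simp only [map_neg, neg_apply]
  ring

theorem koszul_smul_left (g : Metric M) {X Y Z : VField M} {p : M} {u : M → ℝ}
    (hu : MDifferentiableAt (𝓡 2) 𝓘(ℝ, ℝ) u p)
    (hX : X.DiffAt p) (hY : Y.DiffAt p) (hZ : Z.DiffAt p) :
    koszul g (u • X) Y Z p = u p * koszul g X Y Z p := by
  have h1 : (fun q ↦ g.inner q ((u • X) q) (Z q)) = u * fun q ↦ g.inner q (X q) (Z q) := by
    ext q; simp
  have h2 : (fun q ↦ g.inner q ((u • X) q) (Y q)) = u * fun q ↦ g.inner q (X q) (Y q) := by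
    ext q; simp
  simp only [koszul, deriveAlong, bracket, h1, h2]
  rw [mvfderiv_mul hu (mdifferentiableAt_inner g hX hZ),
    mvfderiv_mul hu (mdifferentiableAt_inner g hX hY),
    VectorField.mlieBracket_smul_left hu hX, VectorField.mlieBracket_smul_left hu hX]
  simp
  ring

theorem koszul_add_left (g : Metric M) {X X' Y Z : VField M} {p : M}
    (hX : X.DiffAt p) (hX' : X'.DiffAt p) (hY : Y.DiffAt p) (hZ : Z.DiffAt p) :
    koszul g (X + X') Y Z p = koszul g X Y Z p + koszul g X' Y Z p := by
  have h1 : (fun q ↦ g.inner q ((X + X') q) (Z q)) =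
      (fun q ↦ g.inner q (X q) (Z q)) + fun q ↦ g.inner q (X' q) (Z q) := by
    ext q; simp
  have h2 : (fun q ↦ g.inner q ((X + X') q) (Y q)) =
      (fun q ↦ g.inner q (X q) (Y q)) + fun q ↦ g.inner q (X' q) (Y q) := by
    ext q; simp
  simp only [koszul, deriveAlong, bracket, h1, h2]
  rw [mvfderiv_add (mdifferentiableAt_inner g hX hZ) (mdifferentiableAt_inner g hX' hZ),
    mvfderiv_add (mdifferentiableAt_inner g hX hY) (mdifferentiableAt_inner g hX' hY),
    VectorField.mlieBracket_add_left hX hX', VectorField.mlieBracket_add_left hX hX']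
  simp
  ring

/-- The Codazzi tensor `∇_X SY - ∇_Y SX - S[X, Y]` of a fundamental pair. -/
def codazzi (g : Metric M) (h : QForm M ℝ) (X Y : VField M) (p : M) : Tan p :=
  leviCivita g X (fun q ↦ shape g h q (Y q)) p - leviCivita g Y (fun q ↦ shape g h q (X q)) p
    - shape g h p (bracket X Y p)

/-- The scalar form `X h(Y, Z) - Y h(X, Z) - h([X, Y], Z) - g(∇_X Z, SY) + g(∇_Y Z, SX)` of the
Codazzi tensor. -/
def codazziForm (g : Metric M) (h : QForm M ℝ) (X Y Z : VField M) (p : M) : ℝ :=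
  deriveAlong X (fun q ↦ h.val q (Y q) (Z q)) p - deriveAlong Y (fun q ↦ h.val q (X q) (Z q)) p
    - h.val p (bracket X Y p) (Z p) - koszul g X Z (fun q ↦ shape g h q (Y q)) p
    + koszul g Y Z (fun q ↦ shape g h q (X q)) p

variable [T2Space M]

/-- By the compatibility of the connection with the metric, the scalar form involves derivatives of
`h` but not of the shape operator. -/
theorem inner_codazzi (g : Metric M) (h : QForm M ℝ) {X Y Z : VField M} {p : M}
    (hX : X.DiffAt p) (hY : Y.DiffAt p) (hZ : Z.DiffAt p) :
    g.inner p (codazzi g h X Y p) (Z p) = codazziForm g h X Y Z p := by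
  have h1 := koszul_add_swap g (X := X) (Y := fun q ↦ shape g h q (Y q)) (Z := Z) (p := p)
  have h2 := koszul_add_swap g (X := Y) (Y := fun q ↦ shape g h q (X q)) (Z := Z) (p := p)
  simp only [inner_shape] at h1 h2
  rw [codazzi, codazziForm, map_sub, map_sub, sub_apply, sub_apply,
    inner_leviCivita g hX (diffAt_shape g h hY) hZ, inner_leviCivita g hY (diffAt_shape g h hX) hZ,
    inner_shape, ← h1, ← h2]
  ring

theorem codazzi_tensorial (g : Metric M) (h : QForm M ℝ) {Y Z : VField M} {p : M}
    (hY : Y.DiffAt p) (hZ : Z.DiffAt p) :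
    TensorialAt (𝓡 2) Plane (fun X : VField M ↦ codazziForm g h X Y Z p) p where
  smul {u X} hu hX := by
    have h1 : (fun q ↦ h.val q ((u • X) q) (Z q)) = u * fun q ↦ h.val q (X q) (Z q) := by
      ext q; simp
    have h2 : (fun q ↦ shape g h q ((u • X) q)) = u • fun q ↦ shape g h q (X q) := by
      ext1 q; simp
    simp only [codazziForm, h2]
    rw [koszul_smul_left g hu hX hZ (diffAt_shape g h hY),
      show koszul g Y Z (u • fun q ↦ shape g h q (X q)) p = _ from
      (koszul_tensorial g hY hZ).smul hu (diffAt_shape g h hX)]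
    simp only [deriveAlong, bracket, h1]
    rw [mvfderiv_mul hu (h.mdifferentiableAt_apply hX hZ),
      VectorField.mlieBracket_smul_left hu hX]
    simp
    ring
  add {X X'} hX hX' := by
    have h1 : (fun q ↦ h.val q ((X + X') q) (Z q)) =
        (fun q ↦ h.val q (X q) (Z q)) + fun q ↦ h.val q (X' q) (Z q) := by
      ext q; simp
    have h2 : (fun q ↦ shape g h q ((X + X') q)) =
        (fun q ↦ shape g h q (X q)) + fun q ↦ shape g h q (X' q) := by
      ext1 q; simp
    simp only [codazziForm, h2]
    rw [koszul_add_left g hX hX' hZ (diffAt_shape g h hY),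
      show koszul g Y Z ((fun q ↦ shape g h q (X q)) + fun q ↦ shape g h q (X' q)) p = _ from
      (koszul_tensorial g hY hZ).add (diffAt_shape g h hX) (diffAt_shape g h hX')]
    simp only [deriveAlong, bracket, h1]
    rw [mvfderiv_add (h.mdifferentiableAt_apply hX hZ) (h.mdifferentiableAt_apply hX' hZ),
      VectorField.mlieBracket_add_left hX hX']
    simp
    ring

theorem codazziForm_swap (g : Metric M) (h : QForm M ℝ) (X Y Z : VField M) (p : M) :
    codazziForm g h X Y Z p = - codazziForm g h Y X Z p := by
  rw [codazziForm, codazziForm, bracket, VectorField.mlieBracket_swap_apply]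
  simp
  ring

/-- A tensorial operation vanishes if it does so on two coordinate fields that span the tangent
plane. -/
theorem tensorial_eq_zero {A : Type*} [AddCommGroup A] [Module ℝ A] {Φ : VField M → A} {p : M}
    (hΦ : TensorialAt (𝓡 2) Plane Φ p) (g : Metric M) {v w : Tan p} (hvw : gram g p v w ≠ 0)
    (hv : Φ (coordField p v) = 0) (hw : Φ (coordField p w) = 0) {X : VField M} (hX : X.DiffAt p) :
    Φ X = 0 := by
  obtain ⟨a, b, hab⟩ := expand_of_gram_ne_zero g hvw (X p)
  have hE : (coordField p v).DiffAt p := (coordField_smooth p v).diffAt p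
  have hF : (coordField p w).DiffAt p := (coordField_smooth p w).diffAt p
  have hc (c : ℝ) : MDifferentiableAt (𝓡 2) 𝓘(ℝ, ℝ) (fun _ : M ↦ c) p := mdifferentiableAt_const
  have haE : VField.DiffAt ((fun _ : M ↦ a) • coordField p v) p := (hc a).smul_section hE
  have hbF : VField.DiffAt ((fun _ : M ↦ b) • coordField p w) p := (hc b).smul_section hF
  have h1 : Φ X = Φ ((fun _ : M ↦ a) • coordField p v + (fun _ : M ↦ b) • coordField p w) := by
    refine hΦ.pointwise hX (mdifferentiableAt_add_section haE hbF) ?_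
    simp [coordField_self, hab]
  rw [h1, hΦ.add haE hbF, hΦ.smul (hc a) hE, hΦ.smul (hc b) hF, hv, hw]
  simp

/-- The Codazzi equation at a point only has to be checked for two coordinate fields. -/
theorem codazzi_eq_zero_of_coordField (g : Metric M) (h : QForm M ℝ) {p : M} {v w : Tan p}
    (hvw : gram g p v w ≠ 0)
    (h1 : codazziForm g h (coordField p v) (coordField p w) (coordField p v) p = 0)
    (h2 : codazziForm g h (coordField p v) (coordField p w) (coordField p w) p = 0)
    {X Y : VField M} (hX : X.DiffAt p) (hY : Y.DiffAt p) : codazzi g h X Y p = 0 := by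
  have hd : ∀ v : Tan p, (coordField p v).DiffAt p := fun v ↦ (coordField_smooth p v).diffAt p
  have key : ∀ Z : VField M, Z.DiffAt p →
      codazziForm g h (coordField p v) (coordField p w) Z p = 0 → codazziForm g h X Y Z p = 0 := by
    intro Z hZ h0
    have hself : ∀ E : VField M, codazziForm g h E E Z p = 0 := fun E ↦ by
      have := codazziForm_swap g h E E Z p
      linarith
    have hright : ∀ E : VField M, E.DiffAt p → codazziForm g h (coordField p v) E Z p = 0 →
        codazziForm g h (coordField p w) E Z p = 0 → codazziForm g h X E Z p = 0 :=
      fun E hE h3 h4 ↦ tensorial_eq_zero (codazzi_tensorial g h hE hZ) g hvw h3 h4 hX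
    rw [codazziForm_swap, neg_eq_zero]
    refine tensorial_eq_zero (codazzi_tensorial g h hX hZ) g hvw ?_ ?_ hY
    · rw [codazziForm_swap, neg_eq_zero]
      refine hright _ (hd v) (hself _) ?_
      rw [codazziForm_swap, h0, neg_zero]
    · rw [codazziForm_swap, neg_eq_zero]
      exact hright _ (hd w) h0 (hself _)
  refine ext_of_gram_ne_zero g hvw ?_ ?_
  · have := inner_codazzi g h hX hY (hd v)
    rw [key _ (hd v) h1, coordField_self] at this
    simpa using this
  · have := inner_codazzi g h hX hY (hd w)
    rw [key _ (hd w) h2, coordField_self] at this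
    simpa using this

/-! ### The operator `∂̄` -/

/-- The value at `p` of `∂̄Q` on the vector field `W + i JW`, applied to `X` and `Y`. -/
def dbar (g : Metric M) (Q : QForm M ℂ) (W X Y : VField M) (p : M) : ℂ :=
  lieDeriv Q W X Y p + Complex.I * lieDeriv Q (fun q ↦ rot g q (W q)) X Y p

theorem lieDeriv_symm (Q : QForm M ℂ) (W X Y : VField M) (p : M) :
    lieDeriv Q W X Y p = lieDeriv Q W Y X p := by
  simp only [lieDeriv, fun q ↦ Q.symm q (X q) (Y q)]
  rw [Q.symm p (X p), Q.symm p _ (Y p)]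
  ring

theorem dbar_symm (g : Metric M) (Q : QForm M ℂ) (W X Y : VField M) (p : M) :
    dbar g Q W X Y p = dbar g Q W Y X p := by
  rw [dbar, dbar, lieDeriv_symm, lieDeriv_symm _ _ X]

theorem lieDeriv_tensorial (Q : QForm M ℂ) {W Y : VField M} {p : M} (hY : Y.DiffAt p) :
    TensorialAt (𝓡 2) Plane (fun X : VField M ↦ lieDeriv Q W X Y p) p where
  smul {u X} hu hX := by
    have h1 : (fun q ↦ Q.val q ((u • X) q) (Y q)) = u • fun q ↦ Q.val q (X q) (Y q) := by
      ext q; simp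
    simp only [lieDeriv, deriveAlong, bracket, h1]
    rw [mvfderiv_smul hu (Q.mdifferentiableAt_apply hX hY),
      VectorField.mlieBracket_smul_right hu hX]
    simp
    ring
  add {X X'} hX hX' := by
    have h1 : (fun q ↦ Q.val q ((X + X') q) (Y q)) =
        (fun q ↦ Q.val q (X q) (Y q)) + fun q ↦ Q.val q (X' q) (Y q) := by
      ext q; simp
    simp only [lieDeriv, deriveAlong, bracket, h1]
    rw [mvfderiv_add (Q.mdifferentiableAt_apply hX hY) (Q.mdifferentiableAt_apply hX' hY),
      VectorField.mlieBracket_add_right hX hX']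
    simp
    ring

theorem dbar_tensorial (g : Metric M) (Q : QForm M ℂ) {W Y : VField M} {p : M} (hY : Y.DiffAt p) :
    TensorialAt (𝓡 2) Plane (fun X : VField M ↦ dbar g Q W X Y p) p where
  smul {u X} hu hX := by
    have h1 := (lieDeriv_tensorial Q (W := W) hY).smul hu hX
    have h2 := (lieDeriv_tensorial Q (W := fun q ↦ rot g q (W q)) hY).smul hu hX
    simp only [dbar] at *
    rw [h1, h2]
    simp
    ring
  add {X X'} hX hX' := by
    have h1 := (lieDeriv_tensorial Q (W := W) hY).add hX hX'
    have h2 := (lieDeriv_tensorial Q (W := fun q ↦ rot g q (W q)) hY).add hX hX'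
    simp only [dbar] at *
    rw [h1, h2]
    ring

/-- The Lie derivative is not tensorial in the vector field along which it is taken. -/
theorem lieDeriv_smul_left (Q : QForm M ℂ) {W X Y : VField M} {p : M} {u : M → ℝ}
    (hu : MDifferentiableAt (𝓡 2) 𝓘(ℝ, ℝ) u p) (hW : W.DiffAt p) :
    lieDeriv Q (u • W) X Y p = u p • lieDeriv Q W X Y p
      + (mvfderiv (𝓡 2) u p (X p) • Q.val p (W p) (Y p)
        + mvfderiv (𝓡 2) u p (Y p) • Q.val p (X p) (W p)) := by
  simp only [lieDeriv, deriveAlong, bracket]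
  rw [VectorField.mlieBracket_smul_left hu hW, VectorField.mlieBracket_smul_left hu hW]
  simp
  ring

theorem lieDeriv_add_left (Q : QForm M ℂ) {W W' X Y : VField M} {p : M}
    (hW : W.DiffAt p) (hW' : W'.DiffAt p) :
    lieDeriv Q (W + W') X Y p = lieDeriv Q W X Y p + lieDeriv Q W' X Y p := by
  simp only [lieDeriv, deriveAlong, bracket]
  rw [VectorField.mlieBracket_add_left hW hW', VectorField.mlieBracket_add_left hW hW']
  simp
  ring

theorem lieDeriv_neg_left (Q : QForm M ℂ) {W X Y : VField M} {p : M} (hW : W.DiffAt p) :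
    lieDeriv Q (fun q ↦ - W q) X Y p = - lieDeriv Q W X Y p := by
  have h := lieDeriv_smul_left Q (X := X) (Y := Y) (u := fun _ : M ↦ (-1 : ℝ))
    mdifferentiableAt_const hW
  have h1 : ((fun _ : M ↦ (-1 : ℝ)) • W : VField M) = fun q ↦ - W q := by
    ext1 q; simp
  rw [h1, mvfderiv_const] at h
  rw [h]
  simp

section Dbar

variable [IsOriented M] {g : Metric M} {Q : QForm M ℂ}
  (hQ : ∀ (p : M) (v w : Tan p), Q.val p (rot g p v) w = Complex.I * Q.val p v w)
include hQ

/-- `∂̄Q` is tensorial in `W`: the terms with derivatives of a factor `u` cancel, because `Q` is of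
type `(2,0)`. -/
theorem dbar_tensorial_left {X Y : VField M} {p : M} :
    TensorialAt (𝓡 2) Plane (fun W : VField M ↦ dbar g Q W X Y p) p where
  smul {u W} hu hW := by
    have h1 : (fun q ↦ rot g q ((u • W) q)) = u • fun q ↦ rot g q (W q) := by
      ext1 q; simp [rot_smul]
    simp only [dbar, h1]
    rw [lieDeriv_smul_left Q hu hW, lieDeriv_smul_left Q hu (diffAt_rot g hW),
      Q.symm p (X p) (rot g p _), hQ, hQ, Q.symm p (W p) (X p)]
    simp only [Complex.real_smul]
    linear_combination (mvfderiv (𝓡 2) u p (X p) * Q.val p (W p) (Y p)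
      + mvfderiv (𝓡 2) u p (Y p) * Q.val p (X p) (W p)) * Complex.I_sq
  add {W W'} hW hW' := by
    have h1 : (fun q ↦ rot g q ((W + W') q)) =
        (fun q ↦ rot g q (W q)) + fun q ↦ rot g q (W' q) := by
      ext1 q; simp [rot_add]
    simp only [dbar, h1]
    rw [lieDeriv_add_left Q hW hW', lieDeriv_add_left Q (diffAt_rot g hW) (diffAt_rot g hW')]
    ring

theorem dbar_rot_left {W X Y : VField M} {p : M} (hW : W.DiffAt p) :
    dbar g Q (fun q ↦ rot g q (W q)) X Y p = - Complex.I * dbar g Q W X Y p := by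
  simp only [dbar, rot_rot]
  rw [lieDeriv_neg_left Q hW]
  linear_combination lieDeriv Q (fun q ↦ rot g q (W q)) X Y p * Complex.I_sq

/-- The equation `∂̄Q = 0` at a point only has to be checked for the coordinate fields of a basis
`v, Jv`. -/
theorem dbar_eq_zero_of_coordField {p : M} {v : Tan p} (hv : v ≠ 0)
    (h11 : dbar g Q (coordField p v) (coordField p v) (coordField p v) p = 0)
    (h12 : dbar g Q (coordField p v) (coordField p v) (coordField p (rot g p v)) p = 0)
    (h22 : dbar g Q (coordField p v) (coordField p (rot g p v)) (coordField p (rot g p v)) p = 0)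
    {W X Y : VField M} (hW : W.DiffAt p) (hX : X.DiffAt p) (hY : Y.DiffAt p) :
    dbar g Q W X Y p = 0 := by
  have hd : ∀ v : Tan p, (coordField p v).DiffAt p := fun v ↦ (coordField_smooth p v).diffAt p
  have hvw : gram g p v (rot g p v) ≠ 0 := by
    rw [gram_rot]
    exact pow_ne_zero 2 (g.pos p v hv).ne'
  have key : ∀ W : VField M,
      dbar g Q W (coordField p v) (coordField p v) p = 0 →
      dbar g Q W (coordField p v) (coordField p (rot g p v)) p = 0 →
      dbar g Q W (coordField p (rot g p v)) (coordField p (rot g p v)) p = 0 →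
      dbar g Q W X Y p = 0 := by
    intro W h1 h2 h3
    have hr : ∀ u : Tan p, dbar g Q W (coordField p v) (coordField p u) p = 0 →
        dbar g Q W (coordField p (rot g p v)) (coordField p u) p = 0 →
        dbar g Q W (coordField p u) X p = 0 := by
      intro u h4 h5
      rw [dbar_symm]
      exact tensorial_eq_zero (dbar_tensorial g Q (hd u)) g hvw h4 h5 hX
    rw [dbar_symm]
    refine tensorial_eq_zero (dbar_tensorial g Q hX) g hvw (hr v h1 ?_) (hr _ h2 h3) hY
    rw [dbar_symm, h2]
  have h0 := key _ h11 h12 h22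
  refine tensorial_eq_zero (dbar_tensorial_left hQ) g hvw h0 ?_ hW
  have h1 : dbar g Q (coordField p (rot g p v)) X Y p
      = dbar g Q (fun q ↦ rot g q (coordField p v q)) X Y p :=
    (dbar_tensorial_left hQ).pointwise (hd _) (diffAt_rot g (hd v)) (by simp [coordField_self])
  rw [h1, dbar_rot_left hQ (hd v), h0, mul_zero]

end Dbar

end

/-! ### The rotation in coordinate fields -/

section

/-- `g(Jx, y)` is the area form, whose square is the Gram determinant. -/
theorem inner_rot_sq (g : Metric M) (p : M) (x y : Tan p) :
    g.inner p (rot g p x) y ^ 2 = gram g p x y := by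
  have hs := gram_stdVec_pos g p
  have hr : (√(gram g p (stdVec p 0) (stdVec p 1)))⁻¹ ^ 2 * gram g p (stdVec p 0) (stdVec p 1)
      = 1 := by
    rw [inv_pow, Real.sq_sqrt hs.le]; field_simp
  rw [inner_rot_left]
  set r := (√(gram g p (stdVec p 0) (stdVec p 1)))⁻¹
  rw [stdVec_expand p x, stdVec_expand p y, gram_comb]
  set a := (show Plane from x) 0
  set b := (show Plane from x) 1
  set c := (show Plane from y) 0
  set d := (show Plane from y) 1
  unfold gram at hr ⊢
  simp only [map_add, map_smul, add_apply, smul_apply, smul_eq_mul,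
    g.symm p (stdVec p 1) (stdVec p 0)]
  set E := g.inner p (stdVec p 0) (stdVec p 0)
  set F := g.inner p (stdVec p 0) (stdVec p 1)
  set G := g.inner p (stdVec p 1) (stdVec p 1)
  linear_combination ((a * d - b * c) ^ 2 * (E * G - F ^ 2)) * hr

section Adapted

variable [T2Space M] [IsOriented M] (A : Metric M) (p : M) (v : Tan p)

/-- The function `A(J E₁, E₂)` for the coordinate fields `E₁`, `E₂` extending `v`, `Jv`. -/
def areaFun (q : M) : ℝ :=
  A.inner q (rot A q (coordField p v q)) (coordField p (rot A p v) q)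

/-- The first coefficient of `J E₁ = α E₁ + β E₂`, where `E₁`, `E₂` are the coordinate fields
extending `v`, `Jv`. -/
def rotCoeff₁ (q : M) : ℝ :=
  - areaFun A p v q * A.inner q (coordField p v q) (coordField p (rot A p v) q)
    / gram A q (coordField p v q) (coordField p (rot A p v) q)

/-- The second coefficient of `J E₁ = α E₁ + β E₂`, where `E₁`, `E₂` are the coordinate fields
extending `v`, `Jv`. -/
def rotCoeff₂ (q : M) : ℝ :=
  areaFun A p v q * A.inner q (coordField p v q) (coordField p v q)
    / gram A q (coordField p v q) (coordField p (rot A p v) q)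

theorem mdifferentiableAt_inner_coordField (v w : Tan p) : MDifferentiableAt (𝓡 2) 𝓘(ℝ, ℝ)
    (fun q ↦ A.inner q (coordField p v q) (coordField p w q)) p :=
  mdifferentiableAt_inner A ((coordField_smooth p v).diffAt p) ((coordField_smooth p w).diffAt p)

theorem mdifferentiableAt_areaFun : MDifferentiableAt (𝓡 2) 𝓘(ℝ, ℝ) (areaFun A p v) p :=
  mdifferentiableAt_inner A (diffAt_rot A ((coordField_smooth p v).diffAt p))
    ((coordField_smooth p (rot A p v)).diffAt p)

variable {A p v} (hv : A.inner p v v = 1)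
include hv

theorem gram_coordField_eq_one : gram A p (coordField p v p) (coordField p (rot A p v) p) = 1 := by
  rw [coordField_self, coordField_self, gram_rot, hv, one_pow]

theorem mdifferentiableAt_gram_inv : MDifferentiableAt (𝓡 2) 𝓘(ℝ, ℝ)
    (fun q ↦ (gram A q (coordField p v q) (coordField p (rot A p v) q))⁻¹) p := by
  refine ContMDiffAt.mdifferentiableAt (n := ∞) (ContMDiffAt.inv₀
    (contMDiffAt_gram A (coordField_smooth p v) (coordField_smooth p _) p) ?_) (by simp)
  rw [gram_coordField_eq_one hv]
  exact one_ne_zero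

theorem mdifferentiableAt_rotCoeff₁ : MDifferentiableAt (𝓡 2) 𝓘(ℝ, ℝ) (rotCoeff₁ A p v) p :=
  ((mdifferentiableAt_areaFun A p v).neg.mul (mdifferentiableAt_inner_coordField A p _ _)).mul
    (mdifferentiableAt_gram_inv hv)

theorem mdifferentiableAt_rotCoeff₂ : MDifferentiableAt (𝓡 2) 𝓘(ℝ, ℝ) (rotCoeff₂ A p v) p :=
  ((mdifferentiableAt_areaFun A p v).mul (mdifferentiableAt_inner_coordField A p _ _)).mul
    (mdifferentiableAt_gram_inv hv)

theorem eventually_rot_coordField : ∀ᶠ q in nhds p, rot A q (coordField p v q) =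
    rotCoeff₁ A p v q • coordField p v q + rotCoeff₂ A p v q • coordField p (rot A p v) q := by
  have h := (contMDiffAt_gram A (coordField_smooth p v) (coordField_smooth p (rot A p v))
    p).continuousAt.eventually_ne (y := 0) (by rw [gram_coordField_eq_one hv]; exact one_ne_zero)
  filter_upwards [h] with q hq
  refine ext_of_gram_ne_zero A hq ?_ ?_
  · rw [inner_rot_self]
    simp only [map_add, map_smul, add_apply, smul_apply, smul_eq_mul, rotCoeff₁, rotCoeff₂,
      A.symm q (coordField p (rot A p v) q) (coordField p v q)]
    ring
  · change areaFun A p v q = _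
    simp only [map_add, map_smul, add_apply, smul_apply, smul_eq_mul, rotCoeff₁, rotCoeff₂]
    field_simp
    rw [gram]
    ring

theorem areaFun_self : areaFun A p v p = 1 := by
  rw [areaFun, coordField_self, coordField_self, inner_rot_rot, hv]

theorem rotCoeff₁_self : rotCoeff₁ A p v p = 0 := by
  rw [rotCoeff₁, coordField_self, coordField_self, A.symm, inner_rot_self]
  simp

theorem rotCoeff₂_self : rotCoeff₂ A p v p = 1 := by
  rw [rotCoeff₂, areaFun_self hv, gram_coordField_eq_one hv, coordField_self, hv]
  norm_num

theorem hasDerivAt_gram_coordField (x : Tan p) :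
    HasDerivAt (fun s ↦ gram A (chartLine p x s) (coordField p v (chartLine p x s))
      (coordField p (rot A p v) (chartLine p x s)))
      (mvfderiv (𝓡 2) (fun q ↦ A.inner q (coordField p v q) (coordField p v q)) p x
        + mvfderiv (𝓡 2) (fun q ↦ A.inner q (coordField p (rot A p v) q)
          (coordField p (rot A p v) q)) p x) 0 := by
  have h11 := hasDerivAt_chartLine (mdifferentiableAt_inner_coordField A p v v) x
  have h12 := hasDerivAt_chartLine (mdifferentiableAt_inner_coordField A p v (rot A p v)) x
  have h22 := hasDerivAt_chartLine
    (mdifferentiableAt_inner_coordField A p (rot A p v) (rot A p v)) x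
  refine ((h11.mul h22).sub (h12.pow 2)).congr_deriv ?_
  simp only [inner_chartLine_zero, coordField_self, inner_rot_rot, hv, A.symm p v (rot A p v),
    inner_rot_self]
  ring

theorem mvfderiv_areaFun (x : Tan p) : mvfderiv (𝓡 2) (areaFun A p v) p x =
      (mvfderiv (𝓡 2) (fun q ↦ A.inner q (coordField p v q) (coordField p v q)) p x
        + mvfderiv (𝓡 2) (fun q ↦ A.inner q (coordField p (rot A p v) q)
          (coordField p (rot A p v) q)) p x) / 2 := by
  have h1 := (hasDerivAt_chartLine (mdifferentiableAt_areaFun A p v) x).pow 2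
  have h2 := hasDerivAt_gram_coordField hv x
  have h3 : (fun s ↦ areaFun A p v (chartLine p x s)) ^ 2 = fun s ↦
      gram A (chartLine p x s) (coordField p v (chartLine p x s))
      (coordField p (rot A p v) (chartLine p x s)) := by
    ext s
    exact inner_rot_sq A _ _ _
  rw [h3] at h1
  have h4 := h1.unique h2
  simp only [chartLine_zero, areaFun_self hv] at h4
  norm_num at h4
  linarith

theorem mvfderiv_rotCoeff₁ (x : Tan p) : mvfderiv (𝓡 2) (rotCoeff₁ A p v) p x =
    - mvfderiv (𝓡 2) (fun q ↦ A.inner q (coordField p v q) (coordField p (rot A p v) q)) p x := by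
  refine mvfderiv_eq_of_hasDerivAt (mdifferentiableAt_rotCoeff₁ hv) ?_
  have h12 := hasDerivAt_chartLine (mdifferentiableAt_inner_coordField A p v (rot A p v)) x
  have hm := hasDerivAt_chartLine (mdifferentiableAt_areaFun A p v) x
  have h0 : gram A (chartLine p x 0) (coordField p v (chartLine p x 0))
      (coordField p (rot A p v) (chartLine p x 0)) = 1 := by
    rw [chartLine_zero, gram_coordField_eq_one hv]
  refine ((hm.neg.mul h12).div (hasDerivAt_gram_coordField hv x)
    (by rw [h0]; exact one_ne_zero)).congr_deriv ?_
  rw [h0]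
  simp only [Pi.neg_apply, Pi.mul_apply, inner_chartLine_zero, chartLine_zero, coordField_self,
    areaFun_self hv,
    A.symm p v (rot A p v), inner_rot_self]
  ring

theorem mvfderiv_rotCoeff₂ (x : Tan p) : mvfderiv (𝓡 2) (rotCoeff₂ A p v) p x =
      (mvfderiv (𝓡 2) (fun q ↦ A.inner q (coordField p v q) (coordField p v q)) p x
        - mvfderiv (𝓡 2) (fun q ↦ A.inner q (coordField p (rot A p v) q)
          (coordField p (rot A p v) q)) p x) / 2 := by
  refine mvfderiv_eq_of_hasDerivAt (mdifferentiableAt_rotCoeff₂ hv) ?_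
  have h11 := hasDerivAt_chartLine (mdifferentiableAt_inner_coordField A p v v) x
  have hm := hasDerivAt_chartLine (mdifferentiableAt_areaFun A p v) x
  rw [mvfderiv_areaFun hv] at hm
  have h0 : gram A (chartLine p x 0) (coordField p v (chartLine p x 0))
      (coordField p (rot A p v) (chartLine p x 0)) = 1 := by
    rw [chartLine_zero, gram_coordField_eq_one hv]
  refine ((hm.mul h11).div (hasDerivAt_gram_coordField hv x)
    (by rw [h0]; exact one_ne_zero)).congr_deriv ?_
  rw [h0]
  simp only [Pi.mul_apply, inner_chartLine_zero, chartLine_zero, coordField_self,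
    areaFun_self hv, hv]
  ring

theorem bracket_rot_coordField (z : Tan p) :
    bracket (fun q ↦ rot A q (coordField p v q)) (coordField p z) p =
      - (mvfderiv (𝓡 2) (rotCoeff₁ A p v) p z) • v
        - (mvfderiv (𝓡 2) (rotCoeff₂ A p v) p z) • rot A p v := by
  have hE := (coordField_smooth p v).diffAt p
  have hF := (coordField_smooth p (rot A p v)).diffAt p
  have ha := mdifferentiableAt_rotCoeff₁ hv
  have hb := mdifferentiableAt_rotCoeff₂ hv
  have h1 : bracket (fun q ↦ rot A q (coordField p v q)) (coordField p z) p =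
      bracket (rotCoeff₁ A p v • coordField p v + rotCoeff₂ A p v • coordField p (rot A p v))
        (coordField p z) p :=
    Filter.EventuallyEq.mlieBracket_vectorField_eq (eventually_rot_coordField hv)
      Filter.EventuallyEq.rfl
  rw [h1, bracket, VectorField.mlieBracket_add_left (ha.smul_section hE) (hb.smul_section hF),
    VectorField.mlieBracket_smul_left ha hE, VectorField.mlieBracket_smul_left hb hF]
  have h2 := coordField_bracket p v z
  have h3 := coordField_bracket p (rot A p v) z
  rw [bracket] at h2 h3
  rw [h2, h3, coordField_self, coordField_self, coordField_self]
  simp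
  abel

/-- `∂̄Q` in terms of the derivatives of the components of `Q` and `A` in a coordinate frame. -/
theorem dbar_coordField (Q : QForm M ℂ) (y z : Tan p) :
    dbar A Q (coordField p v) (coordField p y) (coordField p z) p =
      mvfderiv (𝓡 2) (fun q ↦ Q.val q (coordField p y q) (coordField p z q)) p v
      + Complex.I * (mvfderiv (𝓡 2) (fun q ↦ Q.val q (coordField p y q) (coordField p z q)) p
          (rot A p v)
        + mvfderiv (𝓡 2) (rotCoeff₁ A p v) p y * Q.val p v z
        + mvfderiv (𝓡 2) (rotCoeff₂ A p v) p y * Q.val p (rot A p v) z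
        + mvfderiv (𝓡 2) (rotCoeff₁ A p v) p z * Q.val p y v
        + mvfderiv (𝓡 2) (rotCoeff₂ A p v) p z * Q.val p y (rot A p v)) := by
  rw [dbar, lieDeriv, lieDeriv, bracket_rot_coordField hv, bracket_rot_coordField hv,
    coordField_bracket, coordField_bracket]
  simp [deriveAlong, coordField_self]
  ring

end Adapted

end

/-! ### First derivatives at a point -/

section

theorem eventually_chartLine {p : M} {P : M → Prop} (h : ∀ᶠ q in nhds p, P q) (x : Tan p) :
    ∀ᶠ s in nhds (0 : ℝ), P (chartLine p x s) := by
  have h1 (w : Plane) : ContinuousAt (fun s : ℝ ↦ (extChartAt (𝓡 2) p).symm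
      (extChartAt (𝓡 2) p p + s • w)) 0 := by
    have h2 : ContinuousAt (fun s : ℝ ↦ extChartAt (𝓡 2) p p + s • w) 0 := by fun_prop
    refine ContinuousAt.comp_of_eq (continuousAt_extChartAt_symm p) h2 (by simp)
  have h3 : Filter.Tendsto (chartLine p x) (nhds 0) (nhds (chartLine p x 0)) := h1 x
  rw [chartLine_zero] at h3
  exact h3.eventually h

section Adapted

variable [T2Space M]

theorem mdifferentiableAt_val_coordField {F : Type*} [NormedAddCommGroup F] [NormedSpace ℝ F]
    (h : QForm M F) (p : M) (y z : Tan p) : MDifferentiableAt (𝓡 2) 𝓘(ℝ, F)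
      (fun q ↦ h.val q (coordField p y q) (coordField p z q)) p :=
  h.mdifferentiableAt_apply ((coordField_smooth p y).diffAt p) ((coordField_smooth p z).diffAt p)

theorem koszul_coordField (g : Metric M) (p : M) (x y z : Tan p) :
    koszul g (coordField p x) (coordField p y) (coordField p z) p =
      (mvfderiv (𝓡 2) (fun q ↦ g.inner q (coordField p y q) (coordField p z q)) p x
        + mvfderiv (𝓡 2) (fun q ↦ g.inner q (coordField p x q) (coordField p z q)) p y
        - mvfderiv (𝓡 2) (fun q ↦ g.inner q (coordField p x q) (coordField p y q)) p z) / 2 := by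
  rw [koszul, coordField_bracket, coordField_bracket, coordField_bracket]
  simp only [deriveAlong, coordField_self, map_zero, zero_apply]
  ring

/-- The Codazzi tensor on coordinate fields that extend principal vectors `v`, `w`. Only the values
of the shape operator at `p` enter. -/
theorem codazziForm_coordField (g : Metric M) (h : QForm M ℝ) {p : M} {v w : Tan p} {k₁ k₂ : ℝ}
    (hv : shape g h p v = k₁ • v) (hw : shape g h p w = k₂ • w) (z : Tan p) :
    codazziForm g h (coordField p v) (coordField p w) (coordField p z) p =
      mvfderiv (𝓡 2) (fun q ↦ h.val q (coordField p w q) (coordField p z q)) p v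
      - mvfderiv (𝓡 2) (fun q ↦ h.val q (coordField p v q) (coordField p z q)) p w
      - k₂ * koszul g (coordField p v) (coordField p z) (coordField p w) p
      + k₁ * koszul g (coordField p w) (coordField p z) (coordField p v) p := by
  have hd : ∀ v : Tan p, (coordField p v).DiffAt p := fun v ↦ (coordField_smooth p v).diffAt p
  have key : ∀ (x y : Tan p) (k : ℝ), shape g h p y = k • y →
      koszul g (coordField p x) (coordField p z) (fun q ↦ shape g h q (coordField p y q)) p =
      k * koszul g (coordField p x) (coordField p z) (coordField p y) p := by
    intro x y k hk
    have hc : MDifferentiableAt (𝓡 2) 𝓘(ℝ, ℝ) (fun _ : M ↦ k) p := mdifferentiableAt_const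
    have ht := koszul_tensorial g (hd x) (hd z)
    refine (ht.pointwise (diffAt_shape g h (hd y)) (hc.smul_section (hd y)) ?_).trans
      (ht.smul hc (hd y))
    simp [coordField_self, hk]
  rw [codazziForm, key _ _ _ hv, key _ _ _ hw, coordField_bracket]
  simp [deriveAlong, coordField_self]

variable [IsOriented M] {A : Metric M} {p : M} {v : Tan p} {Q : QForm M ℂ}

theorem mvfderiv_val_symm {F : Type*} [NormedAddCommGroup F] [NormedSpace ℝ F]
    (Q : QForm M F) (p : M) (x y z : Tan p) :
    mvfderiv (𝓡 2) (fun q ↦ Q.val q (coordField p y q) (coordField p z q)) p x =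
    mvfderiv (𝓡 2) (fun q ↦ Q.val q (coordField p z q) (coordField p y q)) p x := by
  simp only [fun q ↦ Q.symm q (coordField p y q) (coordField p z q)]

/-- The derivative of `Q(J E₁, Z) = i Q(E₁, Z)`. -/
theorem mvfderiv_val_rot (hv : A.inner p v v = 1)
    (hQ : ∀ (p : M) (v w : Tan p), Q.val p (rot A p v) w = Complex.I * Q.val p v w) (x z : Tan p) :
    mvfderiv (𝓡 2) (fun q ↦ Q.val q (coordField p (rot A p v) q) (coordField p z q)) p x =
      Complex.I * mvfderiv (𝓡 2) (fun q ↦ Q.val q (coordField p v q) (coordField p z q)) p x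
      - mvfderiv (𝓡 2) (rotCoeff₁ A p v) p x * Q.val p v z
      - mvfderiv (𝓡 2) (rotCoeff₂ A p v) p x * Q.val p (rot A p v) z := by
  have h1 := hasDerivAt_chartLine (mdifferentiableAt_val_coordField Q p v z) x
  have h2 := hasDerivAt_chartLine (mdifferentiableAt_val_coordField Q p (rot A p v) z) x
  have ha := hasDerivAt_chartLine (mdifferentiableAt_rotCoeff₁ hv) x
  have hb := hasDerivAt_chartLine (mdifferentiableAt_rotCoeff₂ hv) x
  have h3 := ((ha.smul h1).add (hb.smul h2)).congr_of_eventuallyEq (f₁ := fun s ↦ Complex.I *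
      Q.val (chartLine p x s) (coordField p v (chartLine p x s)) (coordField p z (chartLine p x s)))
    (by
      filter_upwards [eventually_chartLine (eventually_rot_coordField hv) x] with s hs
      rw [← hQ, hs]
      simp)
  have h4 := (h1.const_mul Complex.I).unique h3
  simp only [chartLine_zero, rotCoeff₁_self hv, rotCoeff₂_self hv, val_chartLine_zero,
    coordField_self, Complex.real_smul] at h4
  rw [h4]
  simp

/-- The derivative of `u A(E, E)² = 4 |Q(E, E)|²`, where `E` extends `v`. -/
theorem mvfderiv_modulus {u : M → ℝ} (hu : MDifferentiableAt (𝓡 2) 𝓘(ℝ, ℝ) u p)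
    (hmod : ∀ (q : M) (v : Tan q), 4 * Complex.normSq (Q.val q v v) = u q * A.inner q v v ^ 2)
    {t : ℝ} (ht : u p = t ^ 2)
    (hv : A.inner p v v = 1) (hQv : Q.val p v v = (t / 2 : ℝ)) (x : Tan p) :
    mvfderiv (𝓡 2) u p x =
      4 * t * (mvfderiv (𝓡 2) (fun q ↦ Q.val q (coordField p v q) (coordField p v q)) p x).re
      - 2 * t ^ 2 *
        mvfderiv (𝓡 2) (fun q ↦ A.inner q (coordField p v q) (coordField p v q)) p x := by
  have h1 := hasDerivAt_chartLine (mdifferentiableAt_val_coordField Q p v v) x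
  have hr := Complex.reCLM.hasFDerivAt.comp_hasDerivAt (0 : ℝ) h1
  have hi := Complex.imCLM.hasFDerivAt.comp_hasDerivAt (0 : ℝ) h1
  have hA := hasDerivAt_chartLine (mdifferentiableAt_inner_coordField A p v v) x
  have hu' := hasDerivAt_chartLine hu x
  have h2 := (((hr.pow 2).add (hi.pow 2)).const_mul 4).congr_of_eventuallyEq
    (f₁ := fun s ↦ u (chartLine p x s) * A.inner (chartLine p x s)
      (coordField p v (chartLine p x s)) (coordField p v (chartLine p x s)) ^ 2)
    (.of_forall fun s ↦ by
      simp [← hmod, Complex.normSq_apply]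
      ring)
  have h3 := (hu'.mul (hA.pow 2)).unique h2
  simp only [Function.comp_apply, Pi.pow_apply, inner_chartLine_zero, chartLine_zero,
    val_chartLine_zero, coordField_self, hv, ht, hQv, Complex.reCLM_apply, Complex.imCLM_apply,
    Complex.ofReal_re, Complex.ofReal_im] at h3
  norm_num at h3
  linarith

end Adapted

end

/-! ### The Codazzi tensor and `∂̄Q` in an adapted basis -/

section

/-- A unit vector `v` on which a form `Q` of type `(2,0)` is real and nonnegative. -/
theorem exists_adapted_vector {A : Metric M} {Q : QForm M ℂ}
    (hQ : ∀ (p : M) (v w : Tan p), Q.val p (rot A p v) w = Complex.I * Q.val p v w) (p : M)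
    {t : ℝ} (ht : 0 ≤ t)
    (hmod : ∀ v : Tan p, 4 * Complex.normSq (Q.val p v v) = t ^ 2 * A.inner p v v ^ 2) :
    ∃ v : Tan p, A.inner p v v = 1 ∧ Q.val p v v = (t / 2 : ℝ) := by
  obtain ⟨e, he⟩ : ∃ e : Tan p, A.inner p e e = 1 := by
    have h0 := A.pos p _ (stdVec_ne_zero p 0)
    refine ⟨(√(A.inner p (stdVec p 0) (stdVec p 0)))⁻¹ • stdVec p 0, ?_⟩
    simp only [map_smul, smul_apply, smul_eq_mul]
    have h1 := Real.sq_sqrt h0.le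
    have h2 := (Real.sqrt_pos.2 h0).ne'
    field_simp
    exact h1.symm
  set q := Q.val p e e with hq
  have hn : ‖q‖ = t / 2 := by
    have h1 := hmod e
    rw [he, Complex.normSq_eq_norm_sq, ← hq] at h1
    have h2 : (2 * ‖q‖) ^ 2 = t ^ 2 := by linarith
    have h3 := (pow_left_inj₀ (by positivity) ht two_ne_zero).1 h2
    linarith
  -- rotating `e` by half of the argument of `Q(e, e)` makes the value real
  set z : ℂ := Complex.exp (-(q.arg / 2 : ℝ) * Complex.I) with hz
  have hz1 : z.re ^ 2 + z.im ^ 2 = 1 := by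
    have h1 : ‖z‖ = 1 := by
      rw [hz]
      have := Complex.norm_exp_ofReal_mul_I (-(q.arg / 2))
      push_cast at this ⊢
      exact this
    have h2 := Complex.normSq_eq_norm_sq z
    rw [h1, Complex.normSq_apply] at h2
    linarith
  have hz2 : z ^ 2 * q = (t / 2 : ℝ) := by
    conv_lhs => rw [← Complex.norm_mul_exp_arg_mul_I q]
    rw [hn, hz, ← Complex.exp_nat_mul, mul_left_comm, ← Complex.exp_add]
    have : ((2 : ℕ) : ℂ) * (-((q.arg / 2 : ℝ) : ℂ) * Complex.I) + (q.arg : ℂ) * Complex.I = 0 := by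
      push_cast; ring
    rw [this, Complex.exp_zero, mul_one]
  have hzz : ((z.re : ℂ) + z.im * Complex.I) = z := Complex.re_add_im z
  refine ⟨z.re • e + z.im • rot A p e, ?_, ?_⟩
  · simp only [map_add, map_smul, add_apply, smul_apply, smul_eq_mul, inner_rot_rot, he,
      inner_rot_self, A.symm p e (rot A p e)]
    linarith
  · simp only [map_add, map_smul, add_apply, smul_apply, Complex.real_smul, hQ]
    rw [Q.symm p e (rot A p e), hQ, ← hq, ← hz2]
    conv_rhs => rw [← hzz]
    ring

section Adapted

variable [T2Space M] [IsOriented M]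

theorem hasDerivAt_comp_chartLine {u : M → ℝ} {p : M} (hu : MDifferentiableAt (𝓡 2) 𝓘(ℝ, ℝ) u p)
    {J : Set ℝ} (huJ : ∀ q, u q ∈ J) {F : ℝ → ℝ} {F' : ℝ} (hF : HasDerivWithinAt F F' J (u p))
    (x : Tan p) :
    HasDerivAt (fun s ↦ F (u (chartLine p x s))) (F' * mvfderiv (𝓡 2) u p x) 0 := by
  have h := hasDerivAt_chartLine hu x
  rw [← hasDerivWithinAt_univ] at h ⊢
  refine HasDerivWithinAt.comp_of_eq (0 : ℝ) hF h (fun s _ ↦ huJ _) ?_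
  rw [chartLine_zero]

variable {A g : Metric M} {p : M} {v : Tan p} {Q : QForm M ℂ} {h : QForm M ℝ} {u : M → ℝ}
  {J : Set ℝ} {C G f : ℝ → ℝ} {f' G' : ℝ}

theorem hasDerivAt_re_val (Q : QForm M ℂ) (p : M) (x y z : Tan p) :
    HasDerivAt (fun s ↦ (Q.val (chartLine p x s) (coordField p y (chartLine p x s))
      (coordField p z (chartLine p x s))).re)
      (mvfderiv (𝓡 2) (fun q ↦ Q.val q (coordField p y q) (coordField p z q)) p x).re 0 :=
  Complex.reCLM.hasFDerivAt.comp_hasDerivAt (0 : ℝ)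
    (hasDerivAt_chartLine (mdifferentiableAt_val_coordField Q p y z) x)

/-- The derivatives of the coefficients of `g = C(u) A - G(u) 2 Re Q`. -/
theorem mvfderiv_first (hu : MDifferentiableAt (𝓡 2) 𝓘(ℝ, ℝ) u p) (huJ : ∀ q, u q ∈ J)
    (hC : HasDerivWithinAt C (f' * G (u p)) J (u p)) (hG : HasDerivWithinAt G G' J (u p))
    (hg : ∀ (q : M) (v w : Tan q),
      g.inner q v w = C (u q) * A.inner q v w - G (u q) * (2 * (Q.val q v w).re)) (x y z : Tan p) :
    mvfderiv (𝓡 2) (fun q ↦ g.inner q (coordField p y q) (coordField p z q)) p x =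
      mvfderiv (𝓡 2) u p x * (f' * G (u p) * A.inner p y z - G' * (2 * (Q.val p y z).re))
      + C (u p) * mvfderiv (𝓡 2) (fun q ↦ A.inner q (coordField p y q) (coordField p z q)) p x
      - G (u p) *
        (2 * (mvfderiv (𝓡 2) (fun q ↦ Q.val q (coordField p y q) (coordField p z q)) p x).re) := by
  have hQ := hasDerivAt_re_val Q p x y z
  have hA := hasDerivAt_chartLine (mdifferentiableAt_inner_coordField A p y z) x
  have hC' := hasDerivAt_comp_chartLine hu huJ hC x
  have hG' := hasDerivAt_comp_chartLine hu huJ hG x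
  refine mvfderiv_eq_of_hasDerivAt (mdifferentiableAt_inner_coordField g p y z) ?_
  simp only [hg]
  refine ((hC'.mul hA).sub (hG'.mul (hQ.const_mul 2))).congr_deriv ?_
  simp only [inner_chartLine_zero, chartLine_zero, val_chartLine_zero, coordField_self]
  ring

/-- The derivatives of the coefficients of `h = f(u) g + C(u) 2 Re Q - u G(u) A`. -/
theorem mvfderiv_second (hu : MDifferentiableAt (𝓡 2) 𝓘(ℝ, ℝ) u p) (huJ : ∀ q, u q ∈ J)
    (hC : HasDerivWithinAt C (f' * G (u p)) J (u p)) (hG : HasDerivWithinAt G G' J (u p))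
    (hf : HasDerivWithinAt f f' J (u p))
    (hh : ∀ (q : M) (v w : Tan q), h.val q v w = f (u q) * g.inner q v w
      + C (u q) * (2 * (Q.val q v w).re) - u q * G (u q) * A.inner q v w) (x y z : Tan p) :
    mvfderiv (𝓡 2) (fun q ↦ h.val q (coordField p y q) (coordField p z q)) p x =
      mvfderiv (𝓡 2) u p x * (f' * g.inner p y z + f' * G (u p) * (2 * (Q.val p y z).re)
        - (G (u p) + u p * G') * A.inner p y z)
      + f (u p) * mvfderiv (𝓡 2) (fun q ↦ g.inner q (coordField p y q) (coordField p z q)) p x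
      + C (u p) *
        (2 * (mvfderiv (𝓡 2) (fun q ↦ Q.val q (coordField p y q) (coordField p z q)) p x).re)
      - u p * G (u p) *
        mvfderiv (𝓡 2) (fun q ↦ A.inner q (coordField p y q) (coordField p z q)) p x := by
  have hQ := hasDerivAt_re_val Q p x y z
  have hA := hasDerivAt_chartLine (mdifferentiableAt_inner_coordField A p y z) x
  have hg := hasDerivAt_chartLine (mdifferentiableAt_inner_coordField g p y z) x
  have hC' := hasDerivAt_comp_chartLine hu huJ hC x
  have hG' := hasDerivAt_comp_chartLine hu huJ hG x
  have hf' := hasDerivAt_comp_chartLine hu huJ hf x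
  have hu' := hasDerivAt_chartLine hu x
  refine mvfderiv_eq_of_hasDerivAt (mdifferentiableAt_val_coordField h p y z) ?_
  simp only [hh]
  refine (((hf'.mul hg).add (hC'.mul (hQ.const_mul 2))).sub
    ((hu'.mul hG').mul hA)).congr_deriv ?_
  simp only [Pi.mul_apply, inner_chartLine_zero, chartLine_zero, val_chartLine_zero,
    coordField_self]
  ring

/-- Both the Codazzi equation for `(g, h)` and the equation `∂̄Q = 0` at `p` amount to the vanishing
of the two numbers `c₁`, `c₂`, which are the components of the Codazzi tensor of `(A, 2 Re Q)`. -/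
theorem exists_codazzi_dbar
    (hQ : ∀ (p : M) (v w : Tan p), Q.val p (rot A p v) w = Complex.I * Q.val p v w)
    (hu : MDifferentiableAt (𝓡 2) 𝓘(ℝ, ℝ) u p) (huJ : ∀ q, u q ∈ J) (hJ : J ⊆ Ici 0)
    (hmod : ∀ (q : M) (v : Tan q), 4 * Complex.normSq (Q.val q v v) = u q * A.inner q v v ^ 2)
    (hC : HasDerivWithinAt C (f' * G (u p)) J (u p)) (hG : HasDerivWithinAt G G' J (u p))
    (hf : HasDerivWithinAt f f' J (u p))
    (hCG : C (u p) ^ 2 - u p * G (u p) ^ 2 = 1)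
    (hG' : 2 * u p * G' = 2 * C (u p) * f' - G (u p))
    (hg : ∀ (q : M) (v w : Tan q),
      g.inner q v w = C (u q) * A.inner q v w - G (u q) * (2 * (Q.val q v w).re))
    (hh : ∀ (q : M) (v w : Tan q), h.val q v w = f (u q) * g.inner q v w
      + C (u q) * (2 * (Q.val q v w).re) - u q * G (u q) * A.inner q v w) :
    ∃ v : Tan p, v ≠ 0 ∧ ∃ c₁ c₂ κ₁ κ₂ : ℝ, κ₁ ≠ 0 ∧ κ₂ ≠ 0 ∧
      codazziForm g h (coordField p v) (coordField p (rot A p v)) (coordField p v) p = κ₁ * c₁ ∧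
      codazziForm g h (coordField p v) (coordField p (rot A p v)) (coordField p (rot A p v)) p
        = κ₂ * c₂ ∧
      dbar A Q (coordField p v) (coordField p v) (coordField p v) p
        = - (c₂ + Complex.I * c₁) / 2 ∧
      dbar A Q (coordField p v) (coordField p v) (coordField p (rot A p v)) p
        = - Complex.I * (c₂ + Complex.I * c₁) / 2 ∧
      dbar A Q (coordField p v) (coordField p (rot A p v)) (coordField p (rot A p v)) p
        = (c₂ + Complex.I * c₁) / 2 := by
  obtain ⟨t, ht0, ht⟩ : ∃ t : ℝ, 0 ≤ t ∧ u p = t ^ 2 :=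
    ⟨√(u p), Real.sqrt_nonneg _, (Real.sq_sqrt (hJ (huJ p))).symm⟩
  obtain ⟨v, hv, hQv⟩ := exists_adapted_vector hQ p ht0 (fun v ↦ by rw [hmod p v, ht])
  have hQvw : Q.val p v (rot A p v) = Complex.I * (t / 2 : ℝ) := by rw [Q.symm, hQ, hQv]
  have hQww : Q.val p (rot A p v) (rot A p v) = - (t / 2 : ℝ) := by
    rw [hQ, hQvw]
    linear_combination ((t / 2 : ℝ) : ℂ) * Complex.I_sq
  have hA12 : A.inner p v (rot A p v) = 0 := by rw [A.symm, inner_rot_self]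
  have hA22 : A.inner p (rot A p v) (rot A p v) = 1 := by rw [inner_rot_rot, hv]
  have hv0 : v ≠ 0 := by rintro rfl; simp at hv
  -- the derivatives of the components of `Q` and of `u`
  have hQ21 := fun x ↦ mvfderiv_val_rot hv hQ x v
  have hQ22 := fun x ↦ mvfderiv_val_rot hv hQ x (rot A p v)
  have hsymm := fun x ↦ mvfderiv_val_symm Q p x v (rot A p v)
  have hdu := mvfderiv_modulus hu hmod ht hv hQv
  have hdg := fun x y z ↦ mvfderiv_first (A := A) (Q := Q) hu huJ hC hG hg x y z
  have hdh := fun x y z ↦ mvfderiv_second (A := A) (g := g) (Q := Q) hu huJ hC hG hf hh x y z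
  have hg11 := hg p v v
  have hg12 := hg p v (rot A p v)
  have hg22 := hg p (rot A p v) (rot A p v)
  have hh11 := hh p v v
  have hh12 := hh p v (rot A p v)
  have hh22 := hh p (rot A p v) (rot A p v)
  have hp1 : C (u p) - t * G (u p) ≠ 0 := fun h0 ↦ by
    have : C (u p) ^ 2 - u p * G (u p) ^ 2 = 0 := by
      rw [ht]; rw [ht] at h0
      linear_combination (C (t ^ 2) + t * G (t ^ 2)) * h0
    linarith
  have hp2 : C (u p) + t * G (u p) ≠ 0 := fun h0 ↦ by
    have : C (u p) ^ 2 - u p * G (u p) ^ 2 = 0 := by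
      rw [ht]; rw [ht] at h0
      linear_combination (C (t ^ 2) - t * G (t ^ 2)) * h0
    linarith
  -- in the basis `v`, `Jv` the forms `g` and `h` are diagonal
  rw [hv, hQv, Complex.ofReal_re] at hg11 hh11
  rw [hA12, hQvw] at hg12 hh12
  rw [hA22, hQww, Complex.neg_re, Complex.ofReal_re] at hg22 hh22
  simp only [Complex.mul_re, Complex.I_re, Complex.I_im, Complex.ofReal_re, Complex.ofReal_im,
    mul_zero, zero_mul, sub_zero] at hg12 hh12
  rw [hg12] at hh12
  have hg21 : g.inner p (rot A p v) v = 0 := by rw [g.symm, hg12]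
  have hh21 : h.val p (rot A p v) v = 0 := by rw [h.symm, hh12]; ring
  have hgram : gram g p v (rot A p v) ≠ 0 := by
    rw [gram, hg11, hg12, hg22]
    intro h0
    have h1 : (C (u p) - t * G (u p)) * (C (u p) + t * G (u p)) = 0 := by
      linear_combination h0
    exact (mul_ne_zero hp1 hp2) h1
  have hS1 : shape g h p v = (f (u p) + t) • v := by
    refine ext_of_gram_ne_zero g hgram ?_ ?_
    · rw [inner_shape, map_smul, smul_apply, smul_eq_mul, hh11, hg11, ht]; ring
    · rw [inner_shape, map_smul, smul_apply, smul_eq_mul, hh12, hg12]; ring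
  have hS2 : shape g h p (rot A p v) = (f (u p) - t) • rot A p v := by
    refine ext_of_gram_ne_zero g hgram ?_ ?_
    · rw [inner_shape, map_smul, smul_apply, smul_eq_mul, hh21, hg21]; ring
    · rw [inner_shape, map_smul, smul_apply, smul_eq_mul, hh22, hg22, ht]; ring
  have hAs (x : Tan p) : mvfderiv (𝓡 2) (fun q ↦
      A.inner q (coordField p (rot A p v) q) (coordField p v q)) p x = mvfderiv (𝓡 2) (fun q ↦
      A.inner q (coordField p v q) (coordField p (rot A p v) q)) p x := by
    simp only [fun q ↦ A.symm q (coordField p (rot A p v) q) (coordField p v q)]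
  have hgs (x : Tan p) : mvfderiv (𝓡 2) (fun q ↦
      g.inner q (coordField p (rot A p v) q) (coordField p v q)) p x = mvfderiv (𝓡 2) (fun q ↦
      g.inner q (coordField p v q) (coordField p (rot A p v) q)) p x := by
    simp only [fun q ↦ g.symm q (coordField p (rot A p v) q) (coordField p v q)]
  have hhs := fun x ↦ mvfderiv_val_symm h p x (rot A p v) v
  simp only [hsymm, hQ21, hQv, hQvw, hQww, Q.symm p (rot A p v) v, mvfderiv_rotCoeff₁ hv,
    mvfderiv_rotCoeff₂ hv] at hQ22
  simp only [hQv, Q.symm p (rot A p v) v, hQvw, mvfderiv_rotCoeff₁ hv, mvfderiv_rotCoeff₂ hv]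
    at hQ21
  obtain ⟨D, hD⟩ : ∃ D : Tan p → ℂ, ∀ x,
      mvfderiv (𝓡 2) (fun q ↦ Q.val q (coordField p v q) (coordField p v q)) p x = D x :=
    ⟨_, fun _ ↦ rfl⟩
  obtain ⟨a, ha⟩ : ∃ a : Tan p → ℝ, ∀ x,
      mvfderiv (𝓡 2) (fun q ↦ A.inner q (coordField p v q) (coordField p v q)) p x = a x :=
    ⟨_, fun _ ↦ rfl⟩
  obtain ⟨b, hb⟩ : ∃ b : Tan p → ℝ, ∀ x,
      mvfderiv (𝓡 2) (fun q ↦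
        A.inner q (coordField p v q) (coordField p (rot A p v) q)) p x = b x :=
    ⟨_, fun _ ↦ rfl⟩
  obtain ⟨c, hc⟩ : ∃ c : Tan p → ℝ, ∀ x, mvfderiv (𝓡 2) (fun q ↦
      A.inner q (coordField p (rot A p v) q) (coordField p (rot A p v) q)) p x = c x :=
    ⟨_, fun _ ↦ rfl⟩
  simp only [hD, ha, hb, hc] at hQ21 hQ22 hdu
  refine ⟨v, hv0, -2 * (D v).im + 2 * t * b v - 2 * (D (rot A p v)).re,
    -2 * (D v).re + (a v - c v) * t + 2 * (D (rot A p v)).im, C (u p) - t * G (u p),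
    C (u p) + t * G (u p), hp1, hp2, ?_, ?_, ?_, ?_, ?_⟩
  · rw [codazziForm_coordField g h hS1 hS2, koszul_coordField, koszul_coordField]
    simp only [hgs, hhs, hdh, hdg, hsymm, hQ21, hD, ha, hb, hg11, hg12, hv, hA12, hQv, hQvw, hdu,
      Complex.sub_re, Complex.mul_re, Complex.mul_im, Complex.I_re, Complex.I_im,
      Complex.ofReal_re, Complex.ofReal_im]
    -- the terms with `G'` add up to a multiple of `2 u G'`
    rw [ht] at hCG hG' ⊢
    linear_combination (2 * t * (D (rot A p v)).re - t ^ 2 * a (rot A p v)) * hG'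
  · rw [codazziForm_coordField g h hS1 hS2, koszul_coordField, koszul_coordField]
    simp only [hgs, hdh, hdg, hsymm, hQ21, hQ22, hb, hc, hg12, hg22, hA12, hA22, hQvw, hQww, hdu,
      Complex.sub_re, Complex.neg_re, Complex.mul_re, Complex.mul_im, Complex.sub_im,
      Complex.I_re, Complex.I_im, Complex.ofReal_re, Complex.ofReal_im]
    rw [ht] at hCG hG' ⊢
    linear_combination -(2 * t * (D v).re - t ^ 2 * a v) * hG'
  all_goals
    rw [dbar_coordField hv]
    simp only [mvfderiv_rotCoeff₁ hv, mvfderiv_rotCoeff₂ hv, hsymm, hQ21, hQ22, hD, ha, hb, hc,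
      Q.symm p (rot A p v) v, hQv, hQvw, hQww]
    rw [Complex.ext_iff]
    constructor <;> simp <;> ring

end Adapted

end

/-! ### Means of a function on an interval -/

section

/-- The weighted mean `∫₀¹ w(τ) F(τ² s) dτ`. -/
def sqMean (w F : ℝ → ℝ) (s : ℝ) : ℝ := ∫ τ in (0 : ℝ)..1, w τ * F (τ ^ 2 * s)

theorem sqMean_congr {w F F₁ : ℝ → ℝ} {b s : ℝ} (h : ∀ r ∈ Icc 0 b, F r = F₁ r)
    (hs : s ∈ Icc 0 b) : sqMean w F s = sqMean w F₁ s := by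
  refine intervalIntegral.integral_congr fun τ hτ ↦ ?_
  rw [uIcc_of_le zero_le_one] at hτ
  have h1 : τ ^ 2 ≤ 1 := pow_le_one₀ hτ.1 hτ.2
  have h2 : τ ^ 2 * s ∈ Icc 0 b :=
    ⟨mul_nonneg (sq_nonneg _) hs.1, (mul_le_of_le_one_left hs.1 h1).trans hs.2⟩
  simp only [h _ h2]

theorem continuous_sqMean {w F : ℝ → ℝ} (hw : Continuous w) (hF : Continuous F) :
    Continuous (sqMean w F) := by
  refine intervalIntegral.continuous_parametric_intervalIntegral_of_continuous' ?_ 0 1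
  simp only [Function.uncurry_def]
  fun_prop

theorem hasDerivAt_sqMean {w F F' : ℝ → ℝ} (hw : Continuous w) (hF' : Continuous F')
    (h : ∀ x, HasDerivAt F (F' x) x) (x : ℝ) :
    HasDerivAt (sqMean w F) (sqMean (fun τ ↦ w τ * τ ^ 2) F' x) x := by
  have hF : Continuous F := continuous_iff_continuousAt.2 fun x ↦ (h x).continuousAt
  have hK : IsCompact (Icc (0 : ℝ) 1 ×ˢ Metric.closedBall x 1) :=
    isCompact_Icc.prod (isCompact_closedBall x 1)
  obtain ⟨C, hC⟩ := hK.exists_bound_of_continuousOn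
    (f := fun z : ℝ × ℝ ↦ w z.1 * z.1 ^ 2 * F' (z.1 ^ 2 * z.2)) (by fun_prop)
  refine (intervalIntegral.hasDerivAt_integral_of_dominated_loc_of_deriv_le
    (F := fun x τ ↦ w τ * F (τ ^ 2 * x)) (F' := fun x τ ↦ w τ * τ ^ 2 * F' (τ ^ 2 * x))
    (bound := fun _ ↦ C) (Metric.closedBall_mem_nhds x one_pos) ?_ ?_ ?_ ?_ ?_ ?_).2
  · refine .of_forall fun y ↦ Continuous.aestronglyMeasurable (by fun_prop)
  · exact Continuous.intervalIntegrable (by fun_prop) _ _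
  · exact Continuous.aestronglyMeasurable (by fun_prop)
  · refine .of_forall fun τ hτ y hy ↦ ?_
    rw [uIoc_of_le zero_le_one] at hτ
    exact hC (τ, y) ⟨⟨hτ.1.le, hτ.2⟩, hy⟩
  · exact intervalIntegrable_const
  · refine .of_forall fun τ _ y _ ↦ ?_
    have h1 := (h (τ ^ 2 * y)).comp y ((hasDerivAt_id y).const_mul (τ ^ 2))
    refine (h1.const_mul (w τ)).congr_deriv ?_
    ring

variable {J : Set ℝ}

theorem exists_Icc_mem_nhdsWithin (hJ : J.OrdConnected) (hJ0 : J ⊆ Ici 0) (h0 : 0 ∈ J) {x : ℝ}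
    (hx : x ∈ J) : ∃ b, Icc 0 b ⊆ J ∧ x ∈ Icc 0 b ∧ Icc 0 b ∈ nhdsWithin x J := by
  by_cases h : ∃ y ∈ J, x < y
  · obtain ⟨y, hy, hxy⟩ := h
    refine ⟨y, hJ.out h0 hy, ⟨hJ0 hx, hxy.le⟩, ?_⟩
    filter_upwards [self_mem_nhdsWithin, mem_nhdsWithin_of_mem_nhds (Iic_mem_nhds hxy)] with z h1 h2
    exact ⟨hJ0 h1, h2⟩
  · push Not at h
    refine ⟨x, hJ.out h0 hx, ⟨hJ0 hx, le_rfl⟩, ?_⟩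
    filter_upwards [self_mem_nhdsWithin] with z h1
    exact ⟨hJ0 h1, h z h1⟩

theorem exists_continuous_extension {F : ℝ → ℝ} {b : ℝ} (hb : 0 ≤ b)
    (hF : ContinuousOn F (Icc 0 b)) : ∃ F₁ : ℝ → ℝ, Continuous F₁ ∧ ∀ r ∈ Icc 0 b, F r = F₁ r := by
  refine ⟨IccExtend hb ((Icc 0 b).domRestrict F), hF.domRestrict.Icc_extend', fun r hr ↦ ?_⟩
  rw [IccExtend_of_mem hb _ hr, domRestrict_apply]

/-- A `C¹` function on `[0, b]` extends to a `C¹` function on the line, to which differentiation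
under the integral sign applies. -/
theorem exists_hasDerivAt_extension {F F' : ℝ → ℝ} {b : ℝ} (hb : 0 ≤ b)
    (hF' : ContinuousOn F' (Icc 0 b))
    (h : ∀ x ∈ Icc 0 b, HasDerivWithinAt F (F' x) (Icc 0 b) x) :
    ∃ F₁ F₁' : ℝ → ℝ, Continuous F₁' ∧ (∀ x, HasDerivAt F₁ (F₁' x) x) ∧
      (∀ r ∈ Icc 0 b, F r = F₁ r) ∧ ∀ r ∈ Icc 0 b, F' r = F₁' r := by
  obtain ⟨F₁', hc, h1⟩ := exists_continuous_extension hb hF'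
  have hd (x : ℝ) : HasDerivAt (fun s ↦ F 0 + ∫ r in (0 : ℝ)..s, F₁' r) (F₁' x) x :=
    (hc.integral_hasStrictDerivAt 0 x).hasDerivAt.const_add _
  refine ⟨_, F₁', hc, hd, fun r hr ↦ ?_, h1⟩
  have h2 := constant_of_has_deriv_right_zero (a := 0) (b := b)
    (f := fun s ↦ F s - (F 0 + ∫ r in (0 : ℝ)..s, F₁' r))
    (fun x hx ↦ ((h x hx).sub (hd x).hasDerivWithinAt).continuousWithinAt) (fun x hx ↦ by
      have hx' : x ∈ Icc 0 b := ⟨hx.1, hx.2.le⟩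
      have h3 := ((h x hx').sub (hd x).hasDerivWithinAt)
      rw [h1 x hx', sub_self] at h3
      refine h3.mono_of_mem_nhdsWithin ?_
      filter_upwards [self_mem_nhdsWithin, mem_nhdsWithin_of_mem_nhds (Iic_mem_nhds hx.2)]
        with z h1 h2
      exact ⟨hx.1.trans h1, h2⟩) r hr
  simpa [sub_eq_zero] using h2

theorem uniqueDiffOn_interval (hJ : J.OrdConnected) (hJn : J.Nontrivial) : UniqueDiffOn ℝ J :=
  uniqueDiffOn_convex hJ.convex (hJ.convex.nontrivial_iff_nonempty_interior.1 hJn)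

/-- The mean `∫₀¹ w(τ) F(τ² s) dτ` is as smooth in `s`, up to the end points of `J`, as `F`. Its
derivative is the mean of `F'` with weight `w(τ) τ²`. -/
theorem contDiffOn_sqMean (hJ : J.OrdConnected) (hJn : J.Nontrivial) (hJ0 : J ⊆ Ici 0)
    (h0 : 0 ∈ J) (n : ℕ) : ∀ {w F : ℝ → ℝ}, Continuous w → ContDiffOn ℝ n F J →
      ContDiffOn ℝ n (sqMean w F) J := by
  have hU := uniqueDiffOn_interval hJ hJn
  induction n with
  | zero =>
    intro w F hw hF
    rw [Nat.cast_zero, contDiffOn_zero] at hF ⊢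
    intro x hx
    obtain ⟨b, hb, hxb, hn⟩ := exists_Icc_mem_nhdsWithin hJ hJ0 h0 hx
    obtain ⟨F₁, hc, h1⟩ := exists_continuous_extension (hxb.1.trans hxb.2) (hF.mono hb)
    refine (continuous_sqMean hw hc).continuousWithinAt.congr_of_eventuallyEq ?_
      (sqMean_congr h1 hxb)
    filter_upwards [hn] with s hs
    exact sqMean_congr h1 hs
  | succ n ih =>
    intro w F hw hF
    rw [Nat.cast_succ, contDiffOn_succ_iff_derivWithin hU] at hF
    have hd : ∀ x ∈ J, HasDerivWithinAt (sqMean w F)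
        (sqMean (fun τ ↦ w τ * τ ^ 2) (derivWithin F J) x) J x := by
      intro x hx
      obtain ⟨b, hb, hxb, hn⟩ := exists_Icc_mem_nhdsWithin hJ hJ0 h0 hx
      obtain ⟨F₁, F₁', hc, hd, h1, h2⟩ := exists_hasDerivAt_extension (F := F)
        (hxb.1.trans hxb.2) (hF.2.2.continuousOn.mono hb)
        fun x hx ↦ ((hF.1 x (hb hx)).hasDerivWithinAt).mono hb
      rw [sqMean_congr h2 hxb]
      refine (hasDerivAt_sqMean hw hc hd x).hasDerivWithinAt.congr_of_eventuallyEq ?_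
        (sqMean_congr h1 hxb)
      filter_upwards [hn] with s hs
      exact sqMean_congr h1 hs
    rw [Nat.cast_succ, contDiffOn_succ_iff_derivWithin hU]
    refine ⟨fun x hx ↦ (hd x hx).differentiableWithinAt, fun h ↦ absurd h (by simp), ?_⟩
    exact (ih (by fun_prop) hF.2.2).congr fun x hx ↦ (hd x hx).derivWithin (hU x hx)

end

/-! ### The functions `cosh φ(t)` and `sinh φ(t) / t` of `t²` -/

section

/-- The function `cosh φ(t)` of `s = t²`, where `t ≥ 0`. -/
def coshSqrt (φ : ℝ → ℝ) (s : ℝ) : ℝ := Real.cosh (φ √s)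

/-- The function `sinh φ(t) / t` of `s = t²`, where `t ≥ 0`. -/
def sinhSqrt (φ : ℝ → ℝ) (s : ℝ) : ℝ := sinhDiv φ √s

theorem coshSqrt_sq (φ : ℝ → ℝ) {t : ℝ} (ht : 0 ≤ t) :
    coshSqrt φ (t ^ 2) = Real.cosh (φ t) := by
  rw [coshSqrt, Real.sqrt_sq ht]

theorem sinhSqrt_sq (φ : ℝ → ℝ) {t : ℝ} (ht : 0 ≤ t) : sinhSqrt φ (t ^ 2) = sinhDiv φ t := by
  rw [sinhSqrt, Real.sqrt_sq ht]

variable {J : Set ℝ} {f φ : ℝ → ℝ} {s : ℝ}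

theorem contDiffOn_derivWithin (hJ : J.OrdConnected) (hJn : J.Nontrivial)
    (hf : ContDiffOn ℝ ∞ f J) : ContDiffOn ℝ ∞ (derivWithin f J) J :=
  ((contDiffOn_infty_iff_derivWithin (uniqueDiffOn_interval hJ hJn)).1 hf).2

section

variable (hJ0 : J ⊆ Ici 0) (hφ : IsAdmissiblePrimitive J f φ)
include hJ0 hφ

theorem continuousOn_coshSqrt : ContinuousOn (coshSqrt φ) J := by
  refine Real.continuous_cosh.comp_continuousOn
    (ContinuousOn.comp (t := {s : ℝ | 0 ≤ s ∧ s ^ 2 ∈ J})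
      (fun t ht ↦ (hφ.hasDeriv t ht.1 ht.2).continuousWithinAt)
      Real.continuous_sqrt.continuousOn fun s hs ↦ ⟨Real.sqrt_nonneg s, ?_⟩)
  rwa [Real.sq_sqrt (hJ0 hs)]

theorem hasDerivWithinAt_comp_sqrt (hs : s ∈ J) (h0 : s ≠ 0) :
    HasDerivWithinAt (fun s ↦ φ √s) (derivWithin f J s / √s) J s := by
  have h1 := hφ.hasDeriv (√s) (Real.sqrt_nonneg s) (by rwa [Real.sq_sqrt (hJ0 hs)])
  have h2 := h1.comp s (Real.hasDerivAt_sqrt h0).hasDerivWithinAt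
    fun r hr ↦ ⟨Real.sqrt_nonneg r, by rwa [Real.sq_sqrt (hJ0 hr)]⟩
  refine h2.congr_deriv ?_
  rw [Real.sq_sqrt (hJ0 hs)]
  ring

theorem hasDerivWithinAt_coshSqrt_of_ne (hs : s ∈ J) (h0 : s ≠ 0) :
    HasDerivWithinAt (coshSqrt φ) (derivWithin f J s * sinhSqrt φ s) J s := by
  have h1 := (hasDerivWithinAt_comp_sqrt hJ0 hφ hs h0).cosh
  refine h1.congr_deriv ?_
  rw [sinhSqrt, sinhDiv, if_neg (Real.sqrt_ne_zero'.2 (lt_of_le_of_ne (hJ0 hs) h0.symm))]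
  ring

theorem hasDerivWithinAt_sinhSqrt_of_ne (hs : s ∈ J) (h0 : s ≠ 0) :
    HasDerivWithinAt (sinhSqrt φ)
      ((2 * coshSqrt φ s * derivWithin f J s - sinhSqrt φ s) / (2 * s)) J s := by
  have hpos : 0 < s := lt_of_le_of_ne (hJ0 hs) h0.symm
  have hr : √s ≠ 0 := Real.sqrt_ne_zero'.2 hpos
  have h1 := (hasDerivWithinAt_comp_sqrt hJ0 hφ hs h0).sinh.div
    (Real.hasDerivAt_sqrt h0).hasDerivWithinAt hr
  have h2 : sinhSqrt φ s = Real.sinh (φ √s) / √s := by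
    rw [sinhSqrt, sinhDiv, if_neg hr]
  refine (h1.congr_of_eventuallyEq ?_ h2).congr_deriv ?_
  · filter_upwards [mem_nhdsWithin_of_mem_nhds (Ioi_mem_nhds hpos)] with r hr'
    rw [sinhSqrt, sinhDiv, if_neg (Real.sqrt_ne_zero'.2 hr')]
    rfl
  · have h3 := Real.sq_sqrt hpos.le
    rw [h2, coshSqrt]
    conv_rhs => rw [← h3, Real.sqrt_sq (Real.sqrt_nonneg s)]
    rw [h3]
    field_simp

theorem coshSqrt_zero (h0 : 0 ∈ J) : coshSqrt φ 0 = 1 := by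
  rw [coshSqrt, Real.sqrt_zero, hφ.map_zero h0, Real.cosh_zero]

theorem coshSqrt_sq_sub (hs : s ∈ J) : coshSqrt φ s ^ 2 - s * sinhSqrt φ s ^ 2 = 1 := by
  by_cases h0 : s = 0
  · subst h0
    rw [coshSqrt_zero hJ0 hφ hs]
    ring
  · have hpos : 0 < s := lt_of_le_of_ne (hJ0 hs) (Ne.symm h0)
    have hr : √s ≠ 0 := Real.sqrt_ne_zero'.2 hpos
    rw [sinhSqrt, sinhDiv, if_neg hr, div_pow, Real.sq_sqrt hpos.le, mul_div_cancel₀ _ h0,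
      coshSqrt, Real.cosh_sq]
    ring

theorem mul_sinhSqrt (hs : s ∈ J) : √s * Real.sinh (φ √s) = s * sinhSqrt φ s := by
  by_cases h0 : s = 0
  · subst h0
    simp
  · have hpos : 0 < s := lt_of_le_of_ne (hJ0 hs) (Ne.symm h0)
    have hr : √s ≠ 0 := Real.sqrt_ne_zero'.2 hpos
    have h3 := Real.sq_sqrt hpos.le
    rw [sinhSqrt, sinhDiv, if_neg hr]
    field_simp
    rw [h3, mul_comm]

variable (hJ : J.OrdConnected) (hJn : J.Nontrivial)
include hJ hJn

theorem sinhSqrt_zero (h0 : 0 ∈ J) : sinhSqrt φ 0 = 2 * derivWithin f J 0 := by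
  rw [sinhSqrt, Real.sqrt_zero, sinhDiv, if_pos rfl]
  have h1 := hφ.hasDeriv 0 le_rfl (by simpa using h0)
  obtain ⟨y, hy, hy0⟩ : ∃ y ∈ J, y ≠ 0 := hJn.exists_ne 0
  have hpos : 0 < y := lt_of_le_of_ne (hJ0 hy) hy0.symm
  have h2 : HasDerivWithinAt φ (2 * derivWithin f J (0 ^ 2)) (Ici 0) 0 := by
    refine h1.mono_of_mem_nhdsWithin ?_
    filter_upwards [self_mem_nhdsWithin,
      mem_nhdsWithin_of_mem_nhds (Iio_mem_nhds (Real.sqrt_pos.2 hpos))] with r h1 h2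
    refine ⟨h1, hJ.out h0 hy ⟨sq_nonneg r, ?_⟩⟩
    rw [← Real.sq_sqrt hpos.le]
    exact pow_le_pow_left₀ h1 h2.le 2
  rw [h2.derivWithin (uniqueDiffOn_Ici 0 0 self_mem_Ici)]
  simp

variable (hf : ContDiffOn ℝ ∞ f J)
include hf

/-- The equation `(sinh φ(t))' = 2 f'(t²) cosh φ(t)`, integrated from `0` to `t`. -/
theorem sinhSqrt_eq_sqMean (h0 : 0 ∈ J) (hs : s ∈ J) : sinhSqrt φ s =
    sqMean (fun _ ↦ 1) (fun s ↦ 2 * coshSqrt φ s * derivWithin f J s) s := by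
  by_cases hs0 : s = 0
  · subst hs0
    simp [sqMean, sinhSqrt_zero hJ0 hφ hJ hJn h0, coshSqrt_zero hJ0 hφ h0]
  have hpos : 0 < s := lt_of_le_of_ne (hJ0 hs) (Ne.symm hs0)
  set t := √s with ht
  have ht2 : t ^ 2 = s := Real.sq_sqrt hpos.le
  have htpos : 0 < t := Real.sqrt_pos.2 hpos
  have hmem : ∀ τ ∈ Icc (0 : ℝ) 1, τ ^ 2 * s ∈ J := fun τ hτ ↦
    hJ.out h0 hs ⟨by positivity, mul_le_of_le_one_left hpos.le (pow_le_one₀ hτ.1 hτ.2)⟩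
  have hmem' : ∀ τ ∈ Icc (0 : ℝ) 1, τ * t ∈ {r : ℝ | 0 ≤ r ∧ r ^ 2 ∈ J} := fun τ hτ ↦
    ⟨mul_nonneg hτ.1 htpos.le, by rw [mul_pow, ht2]; exact hmem τ hτ⟩
  have hd : ∀ τ ∈ Icc (0 : ℝ) 1, HasDerivWithinAt (fun τ ↦ Real.sinh (φ (τ * t)))
      (t * (1 * (2 * coshSqrt φ (τ ^ 2 * s) * derivWithin f J (τ ^ 2 * s)))) (Icc 0 1) τ := by
    intro τ hτ
    have h1 := hφ.hasDeriv (τ * t) (hmem' τ hτ).1 (hmem' τ hτ).2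
    have h2 := (h1.comp τ ((hasDerivAt_id τ).mul_const t).hasDerivWithinAt hmem').sinh
    refine h2.congr_deriv ?_
    have h3 : coshSqrt φ (τ ^ 2 * s) = Real.cosh (φ (τ * t)) := by
      rw [← coshSqrt_sq φ (hmem' τ hτ).1, mul_pow, ht2]
    rw [h3, mul_pow, ht2]
    simp only [Function.comp_apply, id]
    ring
  have hmaps : MapsTo (fun τ : ℝ ↦ τ ^ 2 * s) (uIcc 0 1) J := by
    rw [uIcc_of_le zero_le_one]
    exact hmem
  have hint : ContinuousOn (fun τ ↦
      t * (1 * (2 * coshSqrt φ (τ ^ 2 * s) * derivWithin f J (τ ^ 2 * s)))) (uIcc 0 1) := by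
    have h1 := (continuousOn_coshSqrt hJ0 hφ).comp (f := fun τ : ℝ ↦ τ ^ 2 * s)
      (by fun_prop) hmaps
    have h2 := (contDiffOn_derivWithin hJ hJn hf).continuousOn.comp
      (f := fun τ : ℝ ↦ τ ^ 2 * s) (by fun_prop) hmaps
    exact continuousOn_const.mul (continuousOn_const.mul ((continuousOn_const.mul h1).mul h2))
  have h4 := intervalIntegral.integral_eq_sub_of_hasDeriv_right (a := 0) (b := 1)
    (f := fun τ ↦ Real.sinh (φ (τ * t)))
    (by rw [uIcc_of_le zero_le_one]; exact fun τ hτ ↦ (hd τ hτ).continuousWithinAt)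
    (fun τ hτ ↦ by
      rw [min_eq_left zero_le_one, max_eq_right zero_le_one] at hτ
      exact (hd τ ⟨hτ.1.le, hτ.2.le⟩).mono_of_mem_nhdsWithin
        (mem_nhdsWithin_of_mem_nhds (Icc_mem_nhds hτ.1 hτ.2))) hint.intervalIntegrable
  rw [intervalIntegral.integral_const_mul] at h4
  simp only [one_mul, zero_mul, hφ.map_zero h0, Real.sinh_zero, sub_zero] at h4
  rw [sinhSqrt, sinhDiv, ← ht, if_neg htpos.ne', ← h4, sqMean]
  simp only [one_mul]
  rw [mul_div_cancel_left₀ _ htpos.ne']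

/-- At `s = 0`, where `√s` is not differentiable, the equation `C² - s G² = 1` is used. -/
theorem hasDerivWithinAt_coshSqrt (hs : s ∈ J) :
    HasDerivWithinAt (coshSqrt φ) (derivWithin f J s * sinhSqrt φ s) J s := by
  by_cases h0 : s = 0
  swap
  · exact hasDerivWithinAt_coshSqrt_of_ne hJ0 hφ hs h0
  subst h0
  have hC := continuousOn_coshSqrt hJ0 hφ
  have hd := (contDiffOn_derivWithin hJ hJn hf).continuousOn
  have hG : ContinuousOn (sinhSqrt φ) J := by
    have h1 : ContDiffOn ℝ (0 : ℕ) (fun s ↦ 2 * coshSqrt φ s * derivWithin f J s) J := by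
      rw [Nat.cast_zero, contDiffOn_zero]
      exact (continuousOn_const.mul hC).mul hd
    exact (contDiffOn_sqMean hJ hJn hJ0 hs 0 continuous_const h1).continuousOn.congr
      fun r hr ↦ sinhSqrt_eq_sqMean hJ0 hφ hJ hJn hf hs hr
  have hpos (r : ℝ) : 0 < coshSqrt φ r + 1 := by
    have := Real.cosh_pos (φ √r)
    rw [coshSqrt]
    linarith
  -- near `0`, the function `cosh φ` is `1 + s k(s)` with `k` continuous
  have hk : ContinuousOn (fun r ↦ sinhSqrt φ r ^ 2 / (coshSqrt φ r + 1)) J :=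
    (hG.pow 2).div (hC.add continuousOn_const) fun r _ ↦ (hpos r).ne'
  rw [hasDerivWithinAt_iff_tendsto_slope]
  have h2 := ((hk 0 hs).mono (sdiff_subset (t := {0}))).tendsto
  have h3 : sinhSqrt φ 0 ^ 2 / (coshSqrt φ 0 + 1) = derivWithin f J 0 * sinhSqrt φ 0 := by
    rw [coshSqrt_zero hJ0 hφ hs, sinhSqrt_zero hJ0 hφ hJ hJn hs]
    ring
  rw [← h3]
  refine h2.congr' ?_
  filter_upwards [self_mem_nhdsWithin] with r hr
  have hr0 : r ≠ 0 := hr.2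
  have h4 := coshSqrt_sq_sub hJ0 hφ hr.1
  have h5 := (hpos r).ne'
  rw [slope_def_field, coshSqrt_zero hJ0 hφ hs, sub_zero]
  field_simp
  linarith

/-- If `C` and `G` are of class `C^n`, then `C` is of class `C^(n+1)`, since `C' = f' G`. The same
order of smoothness is obtained for `G` from the integral formula if `0 ∈ J`, and from
`G' = (2 f' C - G) / (2 s)` otherwise. -/
theorem contDiffOn_coshSqrt_sinhSqrt (n : ℕ) :
    ContDiffOn ℝ n (coshSqrt φ) J ∧ ContDiffOn ℝ n (sinhSqrt φ) J := by
  have hU := uniqueDiffOn_interval hJ hJn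
  have hd (n : ℕ) : ContDiffOn ℝ n (derivWithin f J) J :=
    (contDiffOn_derivWithin hJ hJn hf).of_le (by exact_mod_cast le_top)
  have hmain (n : ℕ) (hC : ContDiffOn ℝ n (coshSqrt φ) J) (hG : ContDiffOn ℝ n (sinhSqrt φ) J) :
      ContDiffOn ℝ (n + 1 : ℕ) (coshSqrt φ) J := by
    rw [Nat.cast_succ, contDiffOn_succ_iff_derivWithin hU]
    have h1 := fun x hx ↦ hasDerivWithinAt_coshSqrt hJ0 hφ hJ hJn hf (s := x) hx
    refine ⟨fun x hx ↦ (h1 x hx).differentiableWithinAt, fun h ↦ absurd h (by simp), ?_⟩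
    exact ((hd n).mul hG).congr fun x hx ↦ (h1 x hx).derivWithin (hU x hx)
  by_cases h0 : 0 ∈ J
  · have hG (n : ℕ) (hC : ContDiffOn ℝ n (coshSqrt φ) J) : ContDiffOn ℝ n (sinhSqrt φ) J :=
      (contDiffOn_sqMean hJ hJn hJ0 h0 n continuous_const
        ((contDiffOn_const.mul hC).mul (hd n))).congr
        fun r hr ↦ sinhSqrt_eq_sqMean hJ0 hφ hJ hJn hf h0 hr
    have hC : ContDiffOn ℝ n (coshSqrt φ) J := by
      induction n with
      | zero =>
        rw [Nat.cast_zero, contDiffOn_zero]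
        exact continuousOn_coshSqrt hJ0 hφ
      | succ n ih => exact hmain n ih (hG n ih)
    exact ⟨hC, hG n hC⟩
  · have hne : ∀ x ∈ J, x ≠ 0 := fun x hx h ↦ h0 (h ▸ hx)
    have h1 := fun x hx ↦ hasDerivWithinAt_sinhSqrt_of_ne hJ0 hφ (s := x) hx (hne x hx)
    induction n with
    | zero =>
      simp only [Nat.cast_zero, contDiffOn_zero]
      exact ⟨continuousOn_coshSqrt hJ0 hφ, fun x hx ↦ (h1 x hx).continuousWithinAt⟩
    | succ n ih =>
      refine ⟨hmain n ih.1 ih.2, ?_⟩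
      rw [Nat.cast_succ, contDiffOn_succ_iff_derivWithin hU]
      refine ⟨fun x hx ↦ (h1 x hx).differentiableWithinAt, fun h ↦ absurd h (by simp), ?_⟩
      refine ContDiffOn.congr ?_ fun x hx ↦ (h1 x hx).derivWithin (hU x hx)
      exact (((contDiffOn_const.mul ih.1).mul (hd n)).sub ih.2).div
        (contDiffOn_const.mul contDiffOn_id) fun x hx ↦ mul_ne_zero two_ne_zero (hne x hx)

theorem contDiffOn_coshSqrt : ContDiffOn ℝ ∞ (coshSqrt φ) J :=
  contDiffOn_infty.2 fun n ↦ (contDiffOn_coshSqrt_sinhSqrt hJ0 hφ hJ hJn hf n).1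

theorem contDiffOn_sinhSqrt : ContDiffOn ℝ ∞ (sinhSqrt φ) J :=
  contDiffOn_infty.2 fun n ↦ (contDiffOn_coshSqrt_sinhSqrt hJ0 hφ hJ hJn hf n).2

theorem exists_hasDerivWithinAt_sinhSqrt (hs : s ∈ J) : ∃ G', HasDerivWithinAt (sinhSqrt φ) G' J s ∧
    2 * s * G' = 2 * coshSqrt φ s * derivWithin f J s - sinhSqrt φ s := by
  by_cases h0 : s = 0
  · subst h0
    refine ⟨_, ((contDiffOn_sinhSqrt hJ0 hφ hJ hJn hf).differentiableOn (by simp) 0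
      hs).hasDerivWithinAt, ?_⟩
    rw [coshSqrt_zero hJ0 hφ hs, sinhSqrt_zero hJ0 hφ hJ hJn hs]
    ring
  · refine ⟨_, hasDerivWithinAt_sinhSqrt_of_ne hJ0 hφ hs h0, ?_⟩
    field_simp

end

end

/-! ### Trace-free forms and forms of type `(2,0)` -/

section

/-- A bilinear form on a tangent plane, as a continuous bilinear form. -/
def mkForm {F : Type*} [NormedAddCommGroup F] [NormedSpace ℝ F] {p : M}
    (b : Tan p →ₗ[ℝ] Tan p →ₗ[ℝ] F) : Tan p →L[ℝ] Tan p →L[ℝ] F :=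
  LinearMap.toContinuousLinearMap
    ((LinearMap.toContinuousLinearMap : (Tan p →ₗ[ℝ] F) ≃ₗ[ℝ] (Tan p →L[ℝ] F)).toLinearMap ∘ₗ b)

set_option synthInstance.maxHeartbeats 200000 in
/-- A positive definite form is bounded below by a positive multiple of the square of the norm. -/
theorem isVonNBounded_of_pos (B : Plane →L[ℝ] Plane →L[ℝ] ℝ) (pos : ∀ v, v ≠ 0 → 0 < B v v) :
    Bornology.IsVonNBounded ℝ {v : Plane | B v v < 1} := by
  have hc : Continuous (fun v ↦ B v v) := B.continuous.clm_apply continuous_id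
  obtain ⟨x, hx, hmin⟩ := (isCompact_sphere (0 : Plane) 1).exists_isMinOn
    (NormedSpace.sphere_nonempty.2 zero_le_one) hc.continuousOn
  have hm : 0 < B x x := pos x (by rintro rfl; simp at hx)
  rw [NormedSpace.isVonNBounded_iff, isBounded_iff_forall_norm_le]
  refine ⟨1 / B x x + 1, fun v hv ↦ ?_⟩
  by_cases hv0 : v = 0
  · subst hv0
    rw [norm_zero]
    positivity
  have hn : 0 < ‖v‖ := norm_pos_iff.2 hv0
  have h1 : B x x ≤ B (‖v‖⁻¹ • v) (‖v‖⁻¹ • v) := hmin (by simp [norm_smul, hn.ne'])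
  simp only [map_smul, smul_apply, smul_eq_mul] at h1
  have h2 : B x x * ‖v‖ ^ 2 ≤ B v v := by
    have h3 := mul_le_mul_of_nonneg_right h1 (sq_nonneg ‖v‖)
    have h4 : ‖v‖⁻¹ * (‖v‖⁻¹ * B v v) * ‖v‖ ^ 2 = B v v := by field_simp
    rwa [h4] at h3
  have h5 : B x x * ‖v‖ ^ 2 < 1 := h2.trans_lt hv
  by_contra! h6
  have h7 : B x x * (1 / B x x + 1) = 1 + B x x := by field_simp
  have h8 := mul_lt_mul_of_pos_left h6 hm
  have h9 : 1 < ‖v‖ := lt_trans (by linarith [one_div_pos.2 hm]) h6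
  nlinarith [mul_lt_mul_of_pos_left h9 (mul_pos hm hn)]

/-- A positive definite quadratic form, as a Riemannian metric. -/
def toMetric (h : QForm M ℝ) (pos : ∀ (p : M) (v : Tan p), v ≠ 0 → 0 < h.val p v v) :
    Metric M where
  inner := h.val
  symm := h.symm
  pos := pos
  isVonNBounded p := isVonNBounded_of_pos (h.val p) (pos p)
  contMDiff := h.contMDiff

/-- `B` is trace-free with respect to `g`, and `-u` is its determinant. Both are expressed by means
of the coefficients of the forms on arbitrary pairs of vectors. -/
def IsTraceFree (g : Metric M) (B : QForm M ℝ) (u : M → ℝ) : Prop :=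
  ∀ (p : M) (v w : Tan p),
    g.inner p w w * B.val p v v - 2 * g.inner p v w * B.val p v w
      + g.inner p v v * B.val p w w = 0 ∧
    B.val p v v * B.val p w w - B.val p v w ^ 2 = - u p * gram g p v w

variable {g A : Metric M} {B : QForm M ℝ} {Q : QForm M ℂ} {u : M → ℝ}

namespace IsTraceFree

theorem val_rot_self (hB : IsTraceFree g B u) (p : M) (v : Tan p) :
    B.val p (rot g p v) (rot g p v) = - B.val p v v := by
  by_cases hv : v = 0
  · have h0 : rot g p 0 = 0 := by simpa using rot_smul g p 0 0
    simp [hv, h0]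
  · have h1 := (hB p v (rot g p v)).1
    rw [inner_rot_rot, g.symm p v (rot g p v), inner_rot_self] at h1
    have h2 := (g.pos p v hv).ne'
    have h3 : g.inner p v v * (B.val p (rot g p v) (rot g p v) + B.val p v v) = 0 := by linarith
    have := (mul_eq_zero.1 h3).resolve_left h2
    linarith

theorem val_rot_rot (hB : IsTraceFree g B u) (p : M) (v w : Tan p) :
    B.val p (rot g p v) (rot g p w) = - B.val p v w := by
  have h := hB.val_rot_self p (v + w)
  simp only [rot_add, map_add, add_apply, hB.val_rot_self p v, hB.val_rot_self p w,
    B.symm p w v, B.symm p (rot g p w) (rot g p v)] at h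
  linarith

theorem val_rot_comm (hB : IsTraceFree g B u) (p : M) (v w : Tan p) :
    B.val p (rot g p v) w = B.val p v (rot g p w) := by
  have h := hB.val_rot_rot p v (rot g p w)
  rw [rot_rot, map_neg] at h
  linarith

theorem sq_add_sq (hB : IsTraceFree g B u) (p : M) (v : Tan p) :
    B.val p v v ^ 2 + B.val p (rot g p v) v ^ 2 = u p * g.inner p v v ^ 2 := by
  have h := (hB p v (rot g p v)).2
  rw [hB.val_rot_self, gram_rot, B.symm p v (rot g p v)] at h
  linarith

end IsTraceFree

section

variable [T2Space M]

/-- The form `a h + b k`. -/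
def QForm.comb (a b : M → ℝ) (ha : ContMDiff (𝓡 2) 𝓘(ℝ, ℝ) ∞ a) (hb : ContMDiff (𝓡 2) 𝓘(ℝ, ℝ) ∞ b)
    (h k : QForm M ℝ) : QForm M ℝ :=
  QForm.mk' (fun p ↦ a p • h.val p + b p • k.val p)
    (fun p v w ↦ by simp [h.symm p v w, k.symm p v w])
    (fun X Y hX hY p ↦ ((ha p).mul (h.contMDiffAt_apply (hX p) (hY p))).add
      ((hb p).mul (k.contMDiffAt_apply (hX p) (hY p))))

theorem QForm.comb_val (a b : M → ℝ) (ha : ContMDiff (𝓡 2) 𝓘(ℝ, ℝ) ∞ a)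
    (hb : ContMDiff (𝓡 2) 𝓘(ℝ, ℝ) ∞ b) (h k : QForm M ℝ) (p : M) (v w : Tan p) :
    (QForm.comb a b ha hb h k).val p v w = a p * h.val p v w + b p * k.val p v w := rfl

/-- The hyperbolic rotation by `(a, c)` of the pair `(g, B)` of a metric and a trace-free form is
again such a pair. -/
theorem exists_hyperbolic_rotation (hB : IsTraceFree g B u) {a c : M → ℝ}
    (ha : ContMDiff (𝓡 2) 𝓘(ℝ, ℝ) ∞ a) (hc : ContMDiff (𝓡 2) 𝓘(ℝ, ℝ) ∞ c)
    (hu : ContMDiff (𝓡 2) 𝓘(ℝ, ℝ) ∞ u) (hpos : ∀ p, 0 < a p)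
    (hac : ∀ p, a p ^ 2 - u p * c p ^ 2 = 1) :
    ∃ (g' : Metric M) (B' : QForm M ℝ), IsTraceFree g' B' u ∧
      (∀ (p : M) (v w : Tan p), g'.inner p v w = a p * g.inner p v w + c p * B.val p v w) ∧
      ∀ (p : M) (v w : Tan p), B'.val p v w = a p * B.val p v w + u p * c p * g.inner p v w := by
  have hg (p : M) (v : Tan p) (hv : v ≠ 0) :
      0 < (QForm.comb a c ha hc (toQForm g) B).val p v v := by
    rw [QForm.comb_val]
    change 0 < a p * g.inner p v v + c p * B.val p v v
    have h1 := hB.sq_add_sq p v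
    have h2 := g.pos p v hv
    have h3 : 0 < a p * g.inner p v v := mul_pos (hpos p) h2
    have h4 : (c p * B.val p v v) ^ 2 < (a p * g.inner p v v) ^ 2 := by
      have h5 : B.val p v v ^ 2 ≤ u p * g.inner p v v ^ 2 := by
        nlinarith [sq_nonneg (B.val p (rot g p v) v)]
      have h6 := mul_le_mul_of_nonneg_left h5 (sq_nonneg (c p))
      have h7 : (a p * g.inner p v v) ^ 2 =
          c p ^ 2 * (u p * g.inner p v v ^ 2) + g.inner p v v ^ 2 := by
        linear_combination g.inner p v v ^ 2 * hac p
      have h8 : 0 < g.inner p v v ^ 2 := pow_pos h2 2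
      rw [mul_pow, h7]
      linarith
    have := (abs_lt.1 (abs_lt_of_sq_lt_sq h4 h3.le)).1
    linarith
  refine ⟨toMetric _ hg, QForm.comb a (fun p ↦ u p * c p) ha (hu.mul hc) B (toQForm g), ?_,
    fun p v w ↦ rfl, fun p v w ↦ rfl⟩
  intro p v w
  obtain ⟨h1, h2⟩ := hB p v w
  have h3 := hac p
  rw [gram] at h2
  change (a p * g.inner p w w + c p * B.val p w w) *
        (a p * B.val p v v + u p * c p * g.inner p v v)
      - 2 * (a p * g.inner p v w + c p * B.val p v w) *
        (a p * B.val p v w + u p * c p * g.inner p v w)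
      + (a p * g.inner p v v + c p * B.val p v v) *
        (a p * B.val p w w + u p * c p * g.inner p w w) = 0 ∧
    (a p * B.val p v v + u p * c p * g.inner p v v) *
        (a p * B.val p w w + u p * c p * g.inner p w w)
      - (a p * B.val p v w + u p * c p * g.inner p v w) ^ 2 =
    - u p * ((a p * g.inner p v v + c p * B.val p v v) * (a p * g.inner p w w + c p * B.val p w w)
      - (a p * g.inner p v w + c p * B.val p v w) ^ 2)
  constructor
  · linear_combination (a p ^ 2 + u p * c p ^ 2) * h1 + 2 * a p * c p * h2
  · linear_combination (2 * a p * c p * u p) * h1 + (a p ^ 2 + u p * c p ^ 2) * h2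

theorem contMDiffAt_val_rot [IsOriented M] (g : Metric M) (B : QForm M ℝ) {X Y : VField M}
    (hX : X.Smooth) (hY : Y.Smooth) (p : M) :
    ContMDiffAt (𝓡 2) 𝓘(ℝ, ℝ) ∞ (fun q ↦ B.val q (rot g q (X q)) (Y q)) p := by
  have hE := coordField_smooth p (stdVec p 0)
  have hF := coordField_smooth p (stdVec p 1)
  have h := (contMDiffAt_inv_sqrt_gram g p).mul
    (((contMDiffAt_inner g hX hE p).mul (B.contMDiffAt_apply (hF p) (hY p))).sub
      ((contMDiffAt_inner g hX hF p).mul (B.contMDiffAt_apply (hE p) (hY p))))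
  refine h.congr_of_eventuallyEq ?_
  filter_upwards [eventually_rot_eq g p] with q hq
  rw [hq]
  simp

/-- The bilinear form `(B(v, w) - i B(Jv, w)) / 2`. -/
def typeForm (g : Metric M) (B : QForm M ℝ) (p : M) : Tan p →L[ℝ] Tan p →L[ℝ] ℂ :=
  mkForm (LinearMap.mk₂ ℝ
    (fun v w ↦ ((B.val p v w : ℂ) - Complex.I * B.val p (rot g p v) w) / 2)
    (fun v v' w ↦ by simp [rot_add]; ring) (fun c v w ↦ by simp [rot_smul]; ring)
    (fun v w w' ↦ by simp; ring) (fun c v w ↦ by simp; ring))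

theorem typeForm_apply (g : Metric M) (B : QForm M ℝ) (p : M) (v w : Tan p) :
    typeForm g B p v w = ((B.val p v w : ℂ) - Complex.I * B.val p (rot g p v) w) / 2 := rfl

/-- A trace-free form is twice the real part of a form of type `(2,0)`. -/
theorem exists_type_two_zero [IsOriented M] (hB : IsTraceFree g B u) : ∃ Q : QForm M ℂ,
    (∀ (p : M) (v w : Tan p), Q.val p (rot g p v) w = Complex.I * Q.val p v w) ∧
    (∀ (p : M) (v w : Tan p), 2 * (Q.val p v w).re = B.val p v w) ∧
    ∀ (p : M) (v : Tan p), 4 * Complex.normSq (Q.val p v v) = u p * g.inner p v v ^ 2 := by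
  have hre (p : M) (v w : Tan p) : (typeForm g B p v w).re = B.val p v w / 2 := by
    rw [typeForm_apply]
    simp
  have him (p : M) (v w : Tan p) : (typeForm g B p v w).im = - B.val p (rot g p v) w / 2 := by
    rw [typeForm_apply]
    simp
  refine ⟨QForm.mk' (typeForm g B) (fun p v w ↦ ?_) (fun X Y hX hY p ↦ ?_), fun p v w ↦ ?_,
    fun p v w ↦ ?_, fun p v ↦ ?_⟩
  · rw [typeForm_apply, typeForm_apply, hB.val_rot_comm, B.symm p v w, B.symm p v (rot g p w)]
  · have h1 := B.contMDiffAt_apply (hX p) (hY p)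
    have h2 := contMDiffAt_val_rot g B hX hY p
    simp only [typeForm_apply]
    have h3 : ContDiff ℝ ∞ (fun z : ℝ × ℝ ↦ ((z.1 : ℂ) - Complex.I * z.2) / 2) := by
      have h4 : ContDiff ℝ ∞ (fun x : ℝ ↦ (x : ℂ)) := Complex.ofRealCLM.contDiff
      exact ((h4.comp contDiff_fst).sub (contDiff_const.mul (h4.comp contDiff_snd))).div_const 2
    exact ContMDiffAt.comp (I' := 𝓘(ℝ, ℝ × ℝ))
      (g := fun z : ℝ × ℝ ↦ ((z.1 : ℂ) - Complex.I * z.2) / 2)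
      (f := fun q ↦ (B.val q (X q) (Y q), B.val q (rot g q (X q)) (Y q))) p
      h3.contMDiff.contMDiffAt (h1.prodMk_space h2)
  · change typeForm g B p (rot g p v) w = Complex.I * typeForm g B p v w
    rw [Complex.ext_iff, Complex.mul_re, Complex.mul_im, hre, hre, him, him, rot_rot]
    simp
    ring
  · change 2 * (typeForm g B p v w).re = _
    rw [hre]
    ring
  · change 4 * Complex.normSq (typeForm g B p v v) = _
    rw [Complex.normSq_apply, hre, him, ← hB.sq_add_sq]
    ring

/-- Twice the real part of a complex quadratic form. -/
def twiceRe (Q : QForm M ℂ) : QForm M ℝ :=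
  QForm.mk' (fun p ↦ mkForm (LinearMap.mk₂ ℝ (fun v w ↦ 2 * (Q.val p v w).re)
      (fun v v' w ↦ by simp; ring) (fun c v w ↦ by simp; ring)
      (fun v w w' ↦ by simp; ring) (fun c v w ↦ by simp; ring)))
    (fun p v w ↦ by
      change 2 * (Q.val p v w).re = 2 * (Q.val p w v).re
      rw [Q.symm])
    (fun X Y hX hY p ↦ by
      have h1 := Q.contMDiffAt_apply (hX p) (hY p)
      have h2 : ContDiff ℝ ∞ (fun z : ℂ ↦ 2 * z.re) := contDiff_const.mul Complex.reCLM.contDiff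
      exact ContMDiffAt.comp (I' := 𝓘(ℝ, ℂ)) (g := fun z : ℂ ↦ 2 * z.re)
        (f := fun q ↦ Q.val q (X q) (Y q)) p h2.contMDiff.contMDiffAt h1)

theorem twiceRe_val (Q : QForm M ℂ) (p : M) (v w : Tan p) :
    (twiceRe Q).val p v w = 2 * (Q.val p v w).re := rfl

end

/-- The values on a pair of vectors `v`, `a v + b Jv` of a form of type `(2,0)`. -/
theorem val_comb_rot (hQ : ∀ (p : M) (v w : Tan p), Q.val p (rot A p v) w = Complex.I * Q.val p v w)
    (p : M) (v : Tan p) (a b : ℝ) :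
    Q.val p v (a • v + b • rot A p v) = (a + Complex.I * b) * Q.val p v v ∧
    Q.val p (a • v + b • rot A p v) (a • v + b • rot A p v)
      = (a + Complex.I * b) ^ 2 * Q.val p v v := by
  simp only [map_add, map_smul, add_apply, smul_apply, hQ, Complex.real_smul,
    Q.symm p v (rot A p v)]
  constructor
  · ring
  · ring

theorem inner_comb_rot (A : Metric M) (p : M) (v : Tan p) (a b : ℝ) :
    A.inner p v (a • v + b • rot A p v) = a * A.inner p v v ∧
    A.inner p (a • v + b • rot A p v) (a • v + b • rot A p v) =
      (a ^ 2 + b ^ 2) * A.inner p v v := by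
  simp only [map_add, map_smul, add_apply, smul_apply, smul_eq_mul, inner_rot_self, inner_rot_rot,
    A.symm p v (rot A p v)]
  constructor <;> ring

/-- A nonzero vector `v` and `Jv` form a basis. -/
theorem exists_comb_rot (A : Metric M) {p : M} {v : Tan p} (hv : v ≠ 0) (w : Tan p) :
    ∃ a b : ℝ, w = a • v + b • rot A p v :=
  expand_of_gram_ne_zero A (by rw [gram_rot]; exact (pow_pos (A.pos p v hv) 2).ne') w

/-- Twice the real part of a form of type `(2,0)` is trace-free, and its determinant is given by the
modulus. -/
theorem isTraceFree_twiceRe [T2Space M]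
    (hQ : ∀ (p : M) (v w : Tan p), Q.val p (rot A p v) w = Complex.I * Q.val p v w)
    (hmod : ∀ (q : M) (v : Tan q), 4 * Complex.normSq (Q.val q v v) = u q * A.inner q v v ^ 2) :
    IsTraceFree A (twiceRe Q) u := by
  intro p v w
  simp only [twiceRe_val, gram]
  by_cases hv : v = 0
  · simp [hv]
  obtain ⟨a, b, rfl⟩ := exists_comb_rot A hv w
  have h := hmod p v
  rw [Complex.normSq_apply] at h
  rw [(val_comb_rot hQ p v a b).1, (val_comb_rot hQ p v a b).2, (inner_comb_rot A p v a b).1,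
    (inner_comb_rot A p v a b).2]
  simp only [sq (_ + _ : ℂ), Complex.mul_re, Complex.mul_im, Complex.add_re, Complex.add_im,
    Complex.ofReal_re, Complex.ofReal_im, Complex.I_re, Complex.I_im]
  constructor
  · ring
  · linear_combination (-b ^ 2) * h

end

/-! ### Curvatures, modulus and holomorphy -/

section

variable {g A : Metric M} {B h : QForm M ℝ} {Q : QForm M ℂ} {u : M → ℝ}

/-- If `II` differs from a multiple `H` of `I` by a trace-free form, then `H` is the mean
curvature. -/
theorem curvatures_of_isTraceFree (hB : IsTraceFree g B u) {p : M} {H : ℝ}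
    (hh : ∀ v w : Tan p, h.val p v w = H * g.inner p v w + B.val p v w) :
    meanCurv g h p = H ∧ extCurv g h p = H ^ 2 - u p := by
  have hg := (gram_stdVec_pos g p).ne'
  obtain ⟨h1, h2⟩ := trace_det_shape g h p hg
  obtain ⟨h3, h4⟩ := hB p (stdVec p 0) (stdVec p 1)
  simp only [hh] at h1 h2
  rw [meanCurv, extCurv]
  constructor
  · refine mul_right_cancel₀ hg ?_
    rw [gram] at h1 h4 ⊢
    linear_combination h1 / 2 + h3 / 2
  · refine mul_right_cancel₀ hg ?_
    rw [gram] at h2 h4 ⊢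
    linear_combination h2 + h4 + H * h3

section

variable [T2Space M]

/-- The form `II - H I` is trace-free with determinant `K - H²`. -/
theorem isTraceFree_of_curvatures
    (hB : ∀ (p : M) (v w : Tan p), B.val p v w = h.val p v w - meanCurv g h p * g.inner p v w) :
    IsTraceFree g B (fun p ↦ meanCurv g h p ^ 2 - extCurv g h p) := by
  intro p v w
  simp only [hB]
  by_cases hg : gram g p v w = 0
  · -- then `v` and `w` are linearly dependent
    by_cases hv : v = 0
    · simp [hv, gram]
    obtain ⟨a, b, rfl⟩ := exists_comb_rot g hv w
    have hb : b = 0 := by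
      have h1 := (g.pos p v hv).ne'
      rw [gram, (inner_comb_rot g p v a b).1, (inner_comb_rot g p v a b).2] at hg
      have h2 : b ^ 2 * g.inner p v v ^ 2 = 0 := by linear_combination hg
      simpa [h1] using h2
    subst hb
    simp only [zero_smul, add_zero, map_smul, smul_apply, smul_eq_mul, gram]
    constructor <;> ring
  · obtain ⟨h1, h2⟩ := trace_det_shape g h p hg
    have h3 : LinearMap.trace ℝ (Tan p) (shape g h p) = 2 * meanCurv g h p := by
      rw [meanCurv]; ring
    rw [h3] at h1
    rw [← extCurv] at h2
    rw [gram] at h1 h2 ⊢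
    constructor
    · linear_combination -h1
    · linear_combination -h2 + meanCurv g h p * h1

theorem contMDiff_curvatures (g : Metric M) (h : QForm M ℝ) :
    ContMDiff (𝓡 2) 𝓘(ℝ, ℝ) ∞ (meanCurv g h) ∧ ContMDiff (𝓡 2) 𝓘(ℝ, ℝ) ∞ (extCurv g h) := by
  have key (p : M) : ContMDiffAt (𝓡 2) 𝓘(ℝ, ℝ) ∞ (meanCurv g h) p ∧
      ContMDiffAt (𝓡 2) 𝓘(ℝ, ℝ) ∞ (extCurv g h) p := by
    set E := coordField p (stdVec p 0) with hE
    set F := coordField p (stdVec p 1) with hF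
    have sE : E.Smooth := coordField_smooth p _
    have sF : F.Smooth := coordField_smooth p _
    have hpos := eventually_gram_pos g p
    have hgr := (contMDiffAt_gram g sE sF p).inv₀ hpos.self_of_nhds.ne'
    have g11 := contMDiffAt_inner g sE sE p
    have g12 := contMDiffAt_inner g sE sF p
    have g22 := contMDiffAt_inner g sF sF p
    have h11 := h.contMDiffAt_apply (sE p) (sE p)
    have h12 := h.contMDiffAt_apply (sE p) (sF p)
    have h22 := h.contMDiffAt_apply (sF p) (sF p)
    have c2 : ContMDiffAt (𝓡 2) 𝓘(ℝ, ℝ) ∞ (fun _ : M ↦ (2 : ℝ)) p := contMDiffAt_const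
    have c3 : ContMDiffAt (𝓡 2) 𝓘(ℝ, ℝ) ∞ (fun _ : M ↦ (1 / 2 : ℝ)) p := contMDiffAt_const
    constructor
    · refine ((c3.mul (((g22.mul h11).sub ((c2.mul g12).mul h12)).add (g11.mul h22))).mul
        hgr).congr_of_eventuallyEq ?_
      filter_upwards [hpos] with q hq
      have hq' : 0 < gram g q (E q) (F q) := hq
      have h1 := (trace_det_shape g h q hq'.ne').1
      rw [meanCurv]
      simp only [Pi.mul_apply, Pi.add_apply]
      field_simp
      linarith
    · refine (((h11.mul h22).sub (h12.pow 2)).mul hgr).congr_of_eventuallyEq ?_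
      filter_upwards [hpos] with q hq
      have hq' : 0 < gram g q (E q) (F q) := hq
      have h1 := (trace_det_shape g h q hq'.ne').2
      rw [extCurv]
      simp only [Pi.mul_apply]
      field_simp
      exact h1
  exact ⟨fun p ↦ (key p).1, fun p ↦ (key p).2⟩

theorem IsModulus.normSq_eq {t : M → ℝ} (ht : IsModulus A Q t) (p : M) (v : Tan p) :
    4 * Complex.normSq (Q.val p v v) = t p ^ 2 * A.inner p v v ^ 2 := by
  have h := (ht p).2 v
  rw [Complex.normSq_eq_norm_sq]
  linear_combination (2 * ‖Q.val p v v‖ + t p * A.inner p v v) * h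

/-- The function `t` itself need not be smooth at its zeros. -/
theorem IsModulus.contMDiff_sq {t : M → ℝ} (ht : IsModulus A Q t) :
    ContMDiff (𝓡 2) 𝓘(ℝ, ℝ) ∞ (fun p ↦ t p ^ 2) := by
  intro p
  set E := coordField p (stdVec p 0) with hE
  have sE : E.Smooth := coordField_smooth p _
  have hA := contMDiffAt_inner A sE sE p
  have hp : A.inner p (E p) (E p) ≠ 0 := by
    rw [hE, coordField_self]
    exact (A.pos p _ (stdVec_ne_zero p 0)).ne'
  have hQ := Q.contMDiffAt_apply (sE p) (sE p)
  have hn : ContDiff ℝ ∞ (fun z : ℂ ↦ 4 * Complex.normSq z) := by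
    have h1 : ContDiff ℝ ∞ Complex.re := Complex.reCLM.contDiff
    have h2 : ContDiff ℝ ∞ Complex.im := Complex.imCLM.contDiff
    simp only [Complex.normSq_apply]
    exact contDiff_const.mul ((h1.mul h1).add (h2.mul h2))
  have hQ' : ContMDiffAt (𝓡 2) 𝓘(ℝ, ℝ) ∞ (fun q ↦ 4 * Complex.normSq (Q.val q (E q) (E q))) p :=
    ContMDiffAt.comp (I' := 𝓘(ℝ, ℂ)) (g := fun z : ℂ ↦ 4 * Complex.normSq z)
      (f := fun q ↦ Q.val q (E q) (E q)) p hn.contMDiff.contMDiffAt hQ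
  refine (hQ'.mul ((hA.pow 2).inv₀ (pow_ne_zero 2 hp))).congr_of_eventuallyEq ?_
  filter_upwards [hA.continuousAt.eventually_ne hp] with q hq
  simp only [Pi.mul_apply, ht.normSq_eq]
  field_simp

variable [IsOriented M]

theorem existsUnique_isModulus
    (hQ : ∀ (p : M) (v w : Tan p), Q.val p (rot A p v) w = Complex.I * Q.val p v w) :
    ∃! t : M → ℝ, IsModulus A Q t := by
  have hpos (p : M) := A.pos p (stdVec p 0) (stdVec_ne_zero p 0)
  refine ⟨fun p ↦ 2 * ‖Q.val p (stdVec p 0) (stdVec p 0)‖ / A.inner p (stdVec p 0) (stdVec p 0),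
    fun p ↦ ⟨div_nonneg (by positivity) (hpos p).le, fun v ↦ ?_⟩, fun t ht ↦ funext fun p ↦ ?_⟩
  · obtain ⟨a, b, rfl⟩ := exists_comb_rot A (stdVec_ne_zero p 0) v
    have h1 := (hpos p).ne'
    have h2 : ‖(a + Complex.I * b : ℂ)‖ ^ 2 = a ^ 2 + b ^ 2 := by
      rw [← Complex.normSq_eq_norm_sq, Complex.normSq_apply]
      simp
      ring
    rw [(val_comb_rot hQ p _ a b).2, (inner_comb_rot A p _ a b).2, norm_mul, norm_pow, h2]
    field_simp
  · rw [eq_div_iff (hpos p).ne', (ht p).2]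

/-- If `(g, h)` is given by the representation formula, then `(g, h)` is a Codazzi pair if and only
if `∂̄Q = 0`. -/
theorem isCodazzi_iff_dbar_eq_zero {J : Set ℝ} {C G f : ℝ → ℝ}
    (hQ : ∀ (p : M) (v w : Tan p), Q.val p (rot A p v) w = Complex.I * Q.val p v w)
    (hu : ContMDiff (𝓡 2) 𝓘(ℝ, ℝ) ∞ u) (huJ : ∀ q, u q ∈ J) (hJ : J ⊆ Ici 0)
    (hmod : ∀ (q : M) (v : Tan q), 4 * Complex.normSq (Q.val q v v) = u q * A.inner q v v ^ 2)
    (hC : ∀ s ∈ J, HasDerivWithinAt C (derivWithin f J s * G s) J s)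
    (hG : ∀ s ∈ J, ∃ G', HasDerivWithinAt G G' J s ∧
      2 * s * G' = 2 * C s * derivWithin f J s - G s)
    (hf : DifferentiableOn ℝ f J) (hCG : ∀ s ∈ J, C s ^ 2 - s * G s ^ 2 = 1)
    (hg : ∀ (q : M) (v w : Tan q),
      g.inner q v w = C (u q) * A.inner q v w - G (u q) * (2 * (Q.val q v w).re))
    (hh : ∀ (q : M) (v w : Tan q), h.val q v w = f (u q) * g.inner q v w
      + C (u q) * (2 * (Q.val q v w).re) - u q * G (u q) * A.inner q v w) :
    IsCodazzi g h ↔ ∀ W X Y : VField M, W.Smooth → X.Smooth → Y.Smooth → ∀ p : M,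
      lieDeriv Q W X Y p + Complex.I * lieDeriv Q (fun q ↦ rot A q (W q)) X Y p = 0 := by
  choose G' hG₁ hG₂ using hG
  have key (p : M) := exists_codazzi_dbar (p := p) hQ ((hu p).mdifferentiableAt (by simp)) huJ hJ
    hmod (hC _ (huJ p)) (hG₁ _ (huJ p)) (hf _ (huJ p)).hasDerivWithinAt (hCG _ (huJ p))
    (hG₂ _ (huJ p)) hg hh
  constructor
  · intro hcod W X Y hW hX hY p
    obtain ⟨v, hv, c₁, c₂, κ₁, κ₂, hκ₁, hκ₂, e1, e2, e3, e4, e5⟩ := key p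
    have hd (x : Tan p) := (coordField_smooth p x).diffAt p
    have h0 (z : Tan p) : codazziForm g h (coordField p v) (coordField p (rot A p v))
        (coordField p z) p = 0 := by
      rw [← inner_codazzi g h (hd _) (hd _) (hd _), codazzi,
        hcod _ _ (coordField_smooth p _) (coordField_smooth p _) p]
      simp
    rw [h0] at e1 e2
    have hc₁ := (mul_eq_zero.1 e1.symm).resolve_left hκ₁
    have hc₂ := (mul_eq_zero.1 e2.symm).resolve_left hκ₂
    refine dbar_eq_zero_of_coordField hQ hv ?_ ?_ ?_ (hW.diffAt p) (hX.diffAt p) (hY.diffAt p)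
    · rw [e3, hc₁, hc₂]; simp
    · rw [e4, hc₁, hc₂]; simp
    · rw [e5, hc₁, hc₂]; simp
  · intro hdbar X Y hX hY p
    obtain ⟨v, hv, c₁, c₂, κ₁, κ₂, hκ₁, hκ₂, e1, e2, e3, e4, e5⟩ := key p
    have h0 : (c₂ + Complex.I * c₁ : ℂ) = 0 := by
      have h1 := hdbar _ _ _ (coordField_smooth p v) (coordField_smooth p (rot A p v))
        (coordField_smooth p (rot A p v)) p
      rw [← dbar, e5] at h1
      simpa using h1
    have hc₁ : c₁ = 0 := by simpa using congrArg Complex.im h0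
    have hc₂ : c₂ = 0 := by simpa using congrArg Complex.re h0
    rw [hc₁, mul_zero] at e1
    rw [hc₂, mul_zero] at e2
    refine codazzi_eq_zero_of_coordField g h (fun hgr ↦ ?_) e1 e2 (hX.diffAt p) (hY.diffAt p)
    -- `v` and `Jv` are linearly independent
    obtain ⟨a, b, hab⟩ := expand_of_gram_ne_zero A
      (by rw [gram_rot]; exact (pow_pos (A.pos p v hv) 2).ne') (stdVec p 0)
    obtain ⟨c, d, hcd⟩ := expand_of_gram_ne_zero A
      (by rw [gram_rot]; exact (pow_pos (A.pos p v hv) 2).ne') (stdVec p 1)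
    have h1 := gram_stdVec_pos g p
    rw [hab, hcd, gram_comb, hgr, mul_zero] at h1
    exact lt_irrefl 0 h1

end

end

end CodazziPair

end

theorem mainTheorem5 {M : Type*} [TopologicalSpace M] [T2Space M]
    [ChartedSpace CodazziPair.Plane M] [IsManifold (𝓡 2) ∞ M] [CodazziPair.IsOriented M]
    (J : Set ℝ) (hJ_interval : J.OrdConnected) (hJ_nontrivial : J.Nontrivial)
    (hJ_nonneg : J ⊆ Ici 0)
    (f φ : ℝ → ℝ) (hf : ContDiffOn ℝ ∞ f J)
    (hφ : CodazziPair.IsAdmissiblePrimitive J f φ) :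
    (∀ (g : CodazziPair.Metric M) (h : CodazziPair.QForm M ℝ),
      CodazziPair.IsSpecialWeingarten J f g h →
      ∃ (A : CodazziPair.Metric M) (Q : CodazziPair.QForm M ℂ) (t : M → ℝ),
        CodazziPair.IsHolomorphicQuadDiff A Q ∧
        CodazziPair.IsModulus A Q t ∧
        (∀ p : M, t p ^ 2 ∈ J) ∧
        CodazziPair.IsGivenBy f φ g h A Q t ∧
        ∀ p : M, t p ^ 2 = CodazziPair.meanCurv g h p ^ 2 - CodazziPair.extCurv g h p) ∧
    (∀ (A : CodazziPair.Metric M) (Q : CodazziPair.QForm M ℂ),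
      CodazziPair.IsHolomorphicQuadDiff A Q →
      ∃! t : M → ℝ, CodazziPair.IsModulus A Q t) ∧
    (∀ (A : CodazziPair.Metric M) (Q : CodazziPair.QForm M ℂ) (t : M → ℝ),
      CodazziPair.IsHolomorphicQuadDiff A Q →
      CodazziPair.IsModulus A Q t →
      (∀ p : M, t p ^ 2 ∈ J) →
      ∃ (g : CodazziPair.Metric M) (h : CodazziPair.QForm M ℝ),
        CodazziPair.IsGivenBy f φ g h A Q t ∧
        CodazziPair.IsSpecialWeingarten J f g h ∧
        ∀ p : M, t p ^ 2 = CodazziPair.meanCurv g h p ^ 2 - CodazziPair.extCurv g h p) := by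
  open CodazziPair in
  have hC := fun s hs ↦ hasDerivWithinAt_coshSqrt (s := s) hJ_nonneg hφ hJ_interval hJ_nontrivial
    hf hs
  have hG := fun s hs ↦ exists_hasDerivWithinAt_sinhSqrt (s := s) hJ_nonneg hφ hJ_interval
    hJ_nontrivial hf hs
  have hCG := fun s hs ↦ coshSqrt_sq_sub (s := s) hJ_nonneg hφ hs
  have hd : DifferentiableOn ℝ f J := hf.differentiableOn (by simp)
  have hcomp {F : ℝ → ℝ} (hF : ContDiffOn ℝ ∞ F J) {u : M → ℝ}
      (hu : ContMDiff (𝓡 2) 𝓘(ℝ, ℝ) ∞ u) (huJ : ∀ p, u p ∈ J) :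
      ContMDiff (𝓡 2) 𝓘(ℝ, ℝ) ∞ (fun p ↦ F (u p)) :=
    hF.contMDiffOn.comp_contMDiff hu huJ
  have sC := contDiffOn_coshSqrt hJ_nonneg hφ hJ_interval hJ_nontrivial hf
  have sG := contDiffOn_sinhSqrt hJ_nonneg hφ hJ_interval hJ_nontrivial hf
  have hCpos (s : ℝ) : 0 < coshSqrt φ s := Real.cosh_pos _
  have hgiven {g A : CodazziPair.Metric M} {h : CodazziPair.QForm M ℝ} {Q : CodazziPair.QForm M ℂ}
      {t : M → ℝ} (ht : ∀ p, 0 ≤ t p) (htJ : ∀ p, t p ^ 2 ∈ J)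
      (hg : ∀ (q : M) (v w : Tan q), g.inner q v w =
        coshSqrt φ (t q ^ 2) * A.inner q v w - sinhSqrt φ (t q ^ 2) * (2 * (Q.val q v w).re))
      (hh : ∀ (q : M) (v w : Tan q), h.val q v w = f (t q ^ 2) * g.inner q v w
        + coshSqrt φ (t q ^ 2) * (2 * (Q.val q v w).re)
        - t q ^ 2 * sinhSqrt φ (t q ^ 2) * A.inner q v w) : IsGivenBy f φ g h A Q t := by
    constructor
    · intro p v w
      rw [hg, coshSqrt_sq φ (ht p), sinhSqrt_sq φ (ht p)]
      rw [Complex.ext_iff]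
      constructor <;> simp
      ring
    · intro p v w
      have h1 := mul_sinhSqrt hJ_nonneg hφ (htJ p)
      rw [Real.sqrt_sq (ht p)] at h1
      rw [hh, h1, coshSqrt_sq φ (ht p)]
      rw [Complex.ext_iff]
      constructor <;> simp <;> ring
  refine ⟨fun g h hW ↦ ?_, fun A Q hQ ↦ existsUnique_isModulus hQ.type_two_zero,
    fun A Q t hQ ht htJ ↦ ?_⟩
  · obtain ⟨sH, sK⟩ := contMDiff_curvatures g h
    set u : M → ℝ := fun p ↦ meanCurv g h p ^ 2 - extCurv g h p with hu
    have su : ContMDiff (𝓡 2) 𝓘(ℝ, ℝ) ∞ u := (sH.pow 2).sub sK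
    have huJ : ∀ p, u p ∈ J := fun p ↦ (hW.2 p).1
    have hH : ∀ p, meanCurv g h p = f (u p) := fun p ↦ (hW.2 p).2
    -- the trace-free part of `h`
    set β : QForm M ℝ := QForm.comb (fun _ ↦ 1) (fun p ↦ - meanCurv g h p) contMDiff_const sH.neg h
      (toQForm g)
    have hβ (p : M) (v w : Tan p) : β.val p v w = h.val p v w - meanCurv g h p * g.inner p v w := by
      rw [QForm.comb_val]
      change 1 * h.val p v w + - meanCurv g h p * g.inner p v w = _
      ring
    obtain ⟨A, B, hB, hA, hB'⟩ := exists_hyperbolic_rotation (isTraceFree_of_curvatures hβ)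
      (hcomp sC su huJ) (hcomp sG su huJ) su (fun p ↦ hCpos _) (fun p ↦ hCG _ (huJ p))
    -- `A = C g + G β` and `B = C β + u G g`; inverting these formulas gives the claim
    obtain ⟨Q, hQ, hQB, hmod⟩ := exists_type_two_zero hB
    have hg (q : M) (v w : Tan q) : g.inner q v w =
        coshSqrt φ (u q) * A.inner q v w - sinhSqrt φ (u q) * (2 * (Q.val q v w).re) := by
      rw [hQB, hA, hB']
      linear_combination (-g.inner q v w) * hCG _ (huJ q)
    have hh (q : M) (v w : Tan q) : h.val q v w = f (u q) * g.inner q v w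
        + coshSqrt φ (u q) * (2 * (Q.val q v w).re)
        - u q * sinhSqrt φ (u q) * A.inner q v w := by
      rw [hQB, hA, hB', ← hH]
      linear_combination (-β.val q v w) * hCG _ (huJ q) - hβ q v w
    have hsq (p : M) : √(u p) ^ 2 = u p := Real.sq_sqrt (hJ_nonneg (huJ p))
    refine ⟨A, Q, fun p ↦ √(u p), ⟨hQ, ?_⟩, fun p ↦ ⟨Real.sqrt_nonneg _, fun v ↦ ?_⟩,
      fun p ↦ by rw [hsq]; exact huJ p, ?_, hsq⟩
    · exact (isCodazzi_iff_dbar_eq_zero hQ su huJ hJ_nonneg hmod hC hG hd hCG hg hh).1 hW.1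
    · have h1 := hmod p v
      rw [Complex.normSq_eq_norm_sq] at h1
      refine (pow_left_inj₀ (by positivity)
        (mul_nonneg (Real.sqrt_nonneg _) (inner_self_nonneg A p v)) two_ne_zero).1 ?_
      rw [mul_pow, mul_pow, hsq]
      linarith
    · refine hgiven (fun p ↦ Real.sqrt_nonneg _) (fun p ↦ by rw [hsq]; exact huJ p) ?_ ?_
      · simpa only [hsq] using hg
      · simpa only [hsq] using hh
  · have su := ht.contMDiff_sq
    obtain ⟨g, B, hB, hg, hB'⟩ := exists_hyperbolic_rotation
      (isTraceFree_twiceRe hQ.type_two_zero ht.normSq_eq) (hcomp sC su htJ) (hcomp sG su htJ).neg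
      su (fun p ↦ hCpos _) (fun p ↦ by rw [neg_sq]; exact hCG _ (htJ p))
    set h : QForm M ℝ := QForm.comb (fun p ↦ f (t p ^ 2)) (fun _ ↦ 1) (hcomp hf su htJ)
      contMDiff_const (toQForm g) B
    have hh₁ (p : M) (v w : Tan p) : h.val p v w = f (t p ^ 2) * g.inner p v w + B.val p v w := by
      rw [QForm.comb_val, one_mul]
      rfl
    have hg₁ (p : M) (v w : Tan p) : g.inner p v w =
        coshSqrt φ (t p ^ 2) * A.inner p v w
          - sinhSqrt φ (t p ^ 2) * (2 * (Q.val p v w).re) := by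
      rw [hg, twiceRe_val]
      ring
    have hh₂ (p : M) (v w : Tan p) : h.val p v w = f (t p ^ 2) * g.inner p v w
        + coshSqrt φ (t p ^ 2) * (2 * (Q.val p v w).re)
        - t p ^ 2 * sinhSqrt φ (t p ^ 2) * A.inner p v w := by
      rw [hh₁, hB', twiceRe_val]
      ring
    have hcurv (p : M) := curvatures_of_isTraceFree hB (hh₁ p)
    have hHK (p : M) : meanCurv g h p ^ 2 - extCurv g h p = t p ^ 2 := by
      rw [(hcurv p).1, (hcurv p).2]
      ring
    refine ⟨g, h, hgiven (fun p ↦ (ht p).1) htJ hg₁ hh₂, ⟨?_, fun p ↦ ?_⟩, fun p ↦ (hHK p).symm⟩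
    · exact (isCodazzi_iff_dbar_eq_zero hQ.type_two_zero su htJ hJ_nonneg ht.normSq_eq hC hG hd
        hCG hg₁ hh₂).2 hQ.dbar_eq_zero
    · rw [hHK]
      exact ⟨htJ p, (hcurv p).1⟩
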